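/- \textbf{Definitions.} Let $G=(V,E)$ be a finite simple undirected graph whose vertices are coloured with two colours, and let $U_1,U_2\subseteq V$ be the colour classes. A nonempty set $S\subseteq V$ is \emph{fair} if $\frac{|S\cap U_i|}{|S|}=\frac{|U_i|}{|V|}$ for $i=1,2$; a partition $\mathcal P$ of $V$ is fair if all of its sets are fair. For $u\in V$ let $\mathcal P[u]$ be the set of $\mathcal P$ that contains $u$, and let $$\mathrm{cost}(G,\mathcal P)=\bigl|\{\{u,v\}\in\tbinom V2\setminus E : \mathcal P[u]=\mathcal P[v]\}\bigr|+\bigl|\{\{u,v\}\in E : \mathcal P[u]\neq\mathcal P[v]\}\bigr| .$$ \textsc{Fair Correlation Clustering} asks, given $G$ and its colouring, for a fair partition of $V$ of minimum cost among all fair partitions of $V$. \textbf{Theorem.} \textsc{Fair Correlation Clustering} on forests with two colours in a ratio of $1:c$, where $c\in\mathbb N_{>0}$, can be solved in time $\mathrm O\bigl(n^{p^3+p^2+p}\bigr)$, where $n$ is the number of vertices and $p=\frac n{c+1}$. That is, there are a single program and a single constant $C$ such that, for all $c\ge 1$ and all forests with $n$ vertices whose two colours occur in the ratio $1:c$, the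 program computes a minimum-cost fair partition in at most $C\cdot n^{p^3+p^2+p}$ steps. Here $n$, $p$ and $c$ may all vary. Programs are word RAM programs: arithmetic operations on words, comparisons and memory accesses take one step each, and all words and addresses are smaller than $C\cdot n^{p^3+p^2+p}$. The input consists of the numbers of vertices and edges, the colour of each vertex, and a list of the edges in arbitrary order; the output consists of a cluster label for each vertex. -/

import Mathlib

namespace FairCC

/-! ### Fair Correlation Clustering -/

section Clustering

variable {V : Type*} [Fintype V] [DecidableEq V]

/-- Intra-cluster cost: the number of unordered pairs of distinct non-adjacent vertices
that lie in the same cluster. -/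
noncomputable def intraCost (G : SimpleGraph V)
    (P : Finpartition (Finset.univ : Finset V)) : ℕ :=
  {e : Sym2 V | ∃ u v, e = s(u, v) ∧ u ≠ v ∧ ¬ G.Adj u v ∧ P.part u = P.part v}.ncard

/-- Inter-cluster cost: the number of edges whose endpoints lie in different clusters. -/
noncomputable def interCost (G : SimpleGraph V)
    (P : Finpartition (Finset.univ : Finset V)) : ℕ :=
  {e : Sym2 V | ∃ u v, e = s(u, v) ∧ G.Adj u v ∧ P.part u ≠ P.part v}.ncard

/-- The correlation clustering cost of a partition. -/
noncomputable def cost (G : SimpleGraph V)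
    (P : Finpartition (Finset.univ : Finset V)) : ℕ :=
  intraCost G P + interCost G P

/-- The vertices of colour `i` in the set `S`. -/
def colorClass {k : ℕ} (col : V → Fin k) (S : Finset V) (i : Fin k) : Finset V :=
  S.filter (fun v => col v = i)

/-- A set is fair if it has the same colour distribution as the whole vertex set. -/
def IsFairSet {k : ℕ} (col : V → Fin k) (S : Finset V) : Prop :=
  ∀ i : Fin k, ((colorClass col S i).card : ℚ) / (S.card : ℚ) =
    ((colorClass col Finset.univ i).card : ℚ) / (Fintype.card V : ℚ)

/-- A partition is fair if all of its clusters are fair. -/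
def IsFairPartition {k : ℕ} (col : V → Fin k)
    (P : Finpartition (Finset.univ : Finset V)) : Prop :=
  ∀ S ∈ P.parts, IsFairSet col S

/-- `P` is a solution of Fair Correlation Clustering on the coloured graph `(G, col)`:
a fair partition of minimum cost among all fair partitions. -/
def IsSolution {k : ℕ} (G : SimpleGraph V) (col : V → Fin k)
    (P : Finpartition (Finset.univ : Finset V)) : Prop :=
  IsFairPartition col P ∧
    ∀ Q : Finpartition (Finset.univ : Finset V), IsFairPartition col Q → cost G P ≤ cost G Q

/-- The two colours occur in the ratio `1 : c`; either of them may be the rarer one. -/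
def HasRatioOneTo (c : ℕ) (col : V → Fin 2) : Prop :=
  ∃ blue red : Fin 2, blue ≠ red ∧
    (colorClass col Finset.univ red).card = c * (colorClass col Finset.univ blue).card

end Clustering

/-! ### The machine model: a word RAM programmed by while-programs

The memory consists of arrays of words; a program refers to finitely many arrays, by constant
names. Every operation on words, every memory access, every test takes one step. -/

/-- The memory: `s a i` is the word in cell `i` of array `a`. -/
abbrev State := ℕ → ℕ → ℕ

/-- The operations on words. Subtraction is truncated at `0`; comparisons return `0` or `1`. -/
inductive Op
  | add | sub | mul | div | mod | lt | eq

def Op.eval : Op → ℕ → ℕ → ℕ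
  | .add, x, y => x + y
  | .sub, x, y => x - y
  | .mul, x, y => x * y
  | .div, x, y => x / y
  | .mod, x, y => x % y
  | .lt, x, y => if x < y then 1 else 0
  | .eq, x, y => if x = y then 1 else 0

/-- Expressions: constants, reading a cell of an array, operations on words. -/
inductive Expr
  | lit (k : ℕ)
  | get (a : ℕ) (i : Expr)
  | op (o : Op) (x y : Expr)

namespace Expr

def eval (s : State) : Expr → ℕ
  | lit k => k
  | get a i => s a (i.eval s)
  | op o x y => o.eval (x.eval s) (y.eval s)

/-- The evaluation of an expression takes one step for each of its nodes. -/
def steps : Expr → ℕ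
  | lit _ => 1
  | get _ i => i.steps + 1
  | op _ x y => x.steps + y.steps + 1

/-- All values that occur in the evaluation, addresses and intermediate results included,
are words, that is, smaller than `W`. -/
def Fits (W : ℕ) (s : State) : Expr → Prop
  | lit k => k < W
  | get a i => i.Fits W s ∧ s a (i.eval s) < W
  | op o x y => x.Fits W s ∧ y.Fits W s ∧ o.eval (x.eval s) (y.eval s) < W

end Expr

/-- Programs. `set a i x` writes the value of `x` to cell `i` of array `a`; the branch and the
loop test whether the value of an expression is different from `0`. -/
inductive Prog
  | skip
  | set (a : ℕ) (i x : Expr)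
  | seq (q r : Prog)
  | ite (b : Expr) (q r : Prog)
  | while (b : Expr) (q : Prog)

/-- The memory after writing the word `x` to cell `i` of array `a`. -/
def State.write (s : State) (a i x : ℕ) : State :=
  fun a' i' => if a' = a ∧ i' = i then x else s a' i'

/-- `Exec W q s s' t`: on a machine with words smaller than `W`, the program `q`, started
in memory `s`, halts in memory `s'` after exactly `t` steps. A run in which some value is not
a word (an overflow) does not count as an execution. -/
inductive Exec (W : ℕ) : Prog → State → State → ℕ → Prop
  | skip (s : State) : Exec W .skip s s 1
  | set (a : ℕ) (i x : Expr) (s : State) (hi : i.Fits W s) (hx : x.Fits W s) :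
      Exec W (.set a i x) s (s.write a (i.eval s) (x.eval s)) (i.steps + x.steps + 1)
  | seq {q r : Prog} {s s' s'' : State} {t t' : ℕ} (hq : Exec W q s s' t)
      (hr : Exec W r s' s'' t') : Exec W (.seq q r) s s'' (t + t')
  | ite_true {b : Expr} {q r : Prog} {s s' : State} {t : ℕ} (hb : b.Fits W s)
      (hne : b.eval s ≠ 0) (hq : Exec W q s s' t) :
      Exec W (.ite b q r) s s' (b.steps + 1 + t)
  | ite_false {b : Expr} {q r : Prog} {s s' : State} {t : ℕ} (hb : b.Fits W s)
      (h0 : b.eval s = 0) (hr : Exec W r s s' t) :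
      Exec W (.ite b q r) s s' (b.steps + 1 + t)
  | while_false {b : Expr} {q : Prog} {s : State} (hb : b.Fits W s) (h0 : b.eval s = 0) :
      Exec W (.while b q) s s (b.steps + 1)
  | while_true {b : Expr} {q : Prog} {s s' s'' : State} {t t' : ℕ} (hb : b.Fits W s)
      (hne : b.eval s ≠ 0) (hq : Exec W q s s' t) (hw : Exec W (.while b q) s' s'' t') :
      Exec W (.while b q) s s'' (b.steps + 1 + t + t')

/-! ### Input and output of a clustering program -/

/-- `edges` lists every edge of `G` exactly once, in any order and any orientation. -/
def ListsEdges {n : ℕ} (G : SimpleGraph (Fin n)) (edges : List (Fin n × Fin n)) : Prop :=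
  (edges.map (fun e => s(e.1, e.2))).Nodup ∧
    ∀ e : Sym2 (Fin n), e ∈ edges.map (fun e => s(e.1, e.2)) ↔ e ∈ G.edgeSet

/-- The initial memory. Array `0` holds the numbers of vertices and edges, array `1` the colours
of the vertices, arrays `2` and `3` the endpoints of the edges. All other cells are `0`. -/
def inputState {n k : ℕ} (col : Fin n → Fin k) (edges : List (Fin n × Fin n)) : State
  | 0, 0 => n
  | 0, 1 => edges.length
  | 1, i => if h : i < n then (col ⟨i, h⟩ : ℕ) else 0
  | 2, i => if h : i < edges.length then (edges[i].1 : ℕ) else 0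
  | 3, i => if h : i < edges.length then (edges[i].2 : ℕ) else 0
  | _, _ => 0

/-- The output is read off array `4`: two vertices lie in the same cluster exactly if
their cells of array `4` hold the same label. -/
def OutputsPartition {n : ℕ} (s : State)
    (P : Finpartition (Finset.univ : Finset (Fin n))) : Prop :=
  ∀ u v : Fin n, P.part u = P.part v ↔ s 4 u = s 4 v

/-- The program `q` solves Fair Correlation Clustering on the coloured graph `(G, col)`, given by
the list `edges` of its edges, in at most `T` steps and with words smaller than `W`. -/
def SolvesWithin {n k : ℕ} (q : Prog) (G : SimpleGraph (Fin n)) (col : Fin n → Fin k)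
    (edges : List (Fin n × Fin n)) (T W : ℕ) : Prop :=
  ∃ (s : State) (t : ℕ), Exec W q (inputState col edges) s t ∧ t ≤ T ∧
    ∃ P : Finpartition (Finset.univ : Finset (Fin n)), OutputsPartition s P ∧ IsSolution G col P

end FairCC

/-! Let `p` be the number of vertices of the rarer colour. Every fair cluster contains such a
vertex, so a fair partition has at most `p` clusters (`card_parts_le`) and is given by a labelling
of the vertices with labels below `p`. Counting ordered pairs, twice the cost is the sum of the
squares of the cluster sizes plus twice the number of edges, minus `n`, minus twice the number of
ordered adjacent pairs inside clusters (`two_mul_cost`). Cluster sizes and fairness depend only on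
the `2 * p` numbers of vertices of each label and colour. So it suffices to know, for each vector of
counts, the maximal number of intra-cluster edges of a labelling realising it.

This is computed by dynamic programming over the forest. The remaining vertices are the roots of
disjoint vertex sets, and the table of a root is indexed by the counts on its set together with the
label of the root. A remaining vertex `u` with no remaining neighbour except possibly `v` is merged
into `v`: the counts add up, and only the edge `uv`, if present, joins the two sets, so its
contribution is read off the two root labels (`Mergeable.combine`, `Merging.table`). A vertex
without remaining neighbours may be merged into any other, so `n - 1` merges leave one table for the
whole vertex set, whether or not the forest is connected. Its best fair cell gives an optimal
labelling (`isBestLabelling_of_table`).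

If both colours occur, all counts are below `n`, so an index is a number with `2 * p + 1` digits in
base `n` and a table has `K = n ^ (2 * p + 1)` cells. A merge treats `K * K` pairs of cells and
copies labellings of length `n`; in total this is of order `n * n * K * K = n ^ (4 * p + 4)`, and `4
* p + 4 ≤ p ^ 3 + p ^ 2 + p` for `p ≥ 2`. For `p ≤ 1` there is at most one cluster and nothing to
compute.

On the machine, all stored words stay below a bound `B`, and every expression is at most quadratic
in stored words with a small coefficient; hence `16 * B ^ 2 < W` excludes overflows
(`Expr.fits_of_ok`), and `Run` carries both bounds through the program. -/

namespace FairCC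

open Finset

/-! ### Leaves of forests -/

/-- Extend `H` to a spanning tree of the complete graph and take a leaf of it with its tree
neighbour. The tree edge need not belong to `H`, so isolated vertices are covered as well. -/
theorem exists_leaf_pair {V : Type*} [Finite V] [Nontrivial V] {H : SimpleGraph V}
    (hH : H.IsAcyclic) : ∃ u v : V, u ≠ v ∧ ∀ w, H.Adj u w → w = v := by
  classical
  have := Fintype.ofFinite V
  obtain ⟨F, hF, -, hac, hr⟩ :=
    SimpleGraph.exists_isAcyclic_reachable_eq_le_of_le_of_isAcyclic (G := ⊤) le_top hH
  have hT : F.IsTree := by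
    refine ⟨?_, hac⟩
    have : Nonempty V := inferInstance
    refine SimpleGraph.Connected.mk fun a b => ?_
    rw [hr]
    exact SimpleGraph.connected_top.preconnected a b
  obtain ⟨u, hu⟩ := hT.exists_vert_degree_one_of_nontrivial
  obtain ⟨v, hv⟩ := Finset.card_eq_one.1 hu
  have hv' : ∀ w, F.Adj u w ↔ w = v := fun w => by
    rw [← SimpleGraph.mem_neighborFinset, hv, Finset.mem_singleton]
  exact ⟨u, v, ((hv' v).2 rfl).ne, fun w hw => (hv' w).1 (hF hw)⟩

/-- A forest extends to a spanning tree, which has `n - 1` edges; without vertices there is no tree,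
whence the separate case. -/
theorem card_edges_le {n : ℕ} {G : SimpleGraph (Fin n)} (hG : G.IsAcyclic)
    {edges : List (Fin n × Fin n)} (he : ListsEdges G edges) : edges.length ≤ n := by
  classical
  rcases n with _ | n
  · rcases edges with _ | ⟨e, _⟩
    · simp
    · exact e.1.elim0
  obtain ⟨F, hF, -, hac, hr⟩ :=
    SimpleGraph.exists_isAcyclic_reachable_eq_le_of_le_of_isAcyclic (G := ⊤) le_top hG
  have hT : F.IsTree := by
    refine ⟨SimpleGraph.Connected.mk fun a b => ?_, hac⟩
    rw [hr]
    exact SimpleGraph.connected_top.preconnected a b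
  have h1 := hT.card_edgeFinset
  have h2 : (edges.map (fun e => s(e.1, e.2))).toFinset ⊆ F.edgeFinset := by
    intro e h
    rw [List.mem_toFinset, he.2] at h
    rw [SimpleGraph.mem_edgeFinset]
    exact SimpleGraph.edgeSet_mono hF h
  have h3 := Finset.card_le_card h2
  rw [List.toFinset_card_of_nodup he.1, List.length_map] at h3
  rw [Fintype.card_fin] at h1
  omega

/-! ### Positional notation -/

theorem sum_digits_lt {n : ℕ} {d : ℕ → ℕ} {M : ℕ} (hd : ∀ i < M, d i < n) :
    ∑ i ∈ range M, d i * n ^ i < n ^ M := by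
  induction M with
  | zero => simp
  | succ M ih =>
    rw [sum_range_succ, pow_succ]
    have h1 := ih fun i hi => hd i (by omega)
    have h2 : (d M + 1) * n ^ M ≤ n * n ^ M := Nat.mul_le_mul_right _ (hd M (by omega))
    linarith

theorem sum_digits_div_mod {n : ℕ} {d : ℕ → ℕ} {M j : ℕ} (hj : j < M)
    (hd : ∀ i < M, d i < n) : (∑ i ∈ range M, d i * n ^ i) / n ^ j % n = d j := by
  have hn : 0 < n := (Nat.zero_le _).trans_lt (hd j hj)
  obtain ⟨m, rfl⟩ : ∃ m, M = j + 1 + m := ⟨M - (j + 1), by omega⟩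
  -- Split at position `j`: division by `n ^ j` removes the lower digits, the remainder modulo `n`
  -- the higher ones.
  have h1 : ∑ i ∈ range (j + 1 + m), d i * n ^ i =
      ∑ i ∈ range j, d i * n ^ i +
        n ^ j * (d j + n * ∑ i ∈ range m, d (j + 1 + i) * n ^ i) := by
    rw [sum_range_add, sum_range_succ, add_assoc, mul_add, mul_comm (d j), mul_sum, mul_sum]
    congr 2
    refine sum_congr rfl fun i _ => ?_
    ring
  rw [h1, Nat.add_mul_div_left _ _ (by positivity),
    Nat.div_eq_of_lt (sum_digits_lt fun i hi => hd i (by omega)), zero_add,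
    Nat.add_mul_mod_self_left, Nat.mod_eq_of_lt (hd j hj)]

/-! ### Codes and scores of labellings -/

/-- The code of the labelling `g` of the vertices in `S`: read in base `n`, its digits are the
numbers of vertices of each label and colour. -/
def code (n : ℕ) (cl : ℕ → ℕ) (S : Finset ℕ) (g : ℕ → ℕ) : ℕ :=
  ∑ v ∈ S, n ^ (2 * g v + cl v + 1)

/-- The key of a labelling of a set of vertices with root `r`. -/
def key (n : ℕ) (cl : ℕ → ℕ) (S : Finset ℕ) (g : ℕ → ℕ) (r : ℕ) : ℕ := code n cl S g + g r

/-- The number of ordered pairs of adjacent vertices in `S × S'` with the same label. -/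
def inner (A : ℕ → ℕ → ℕ) (S S' : Finset ℕ) (g : ℕ → ℕ) : ℕ :=
  ∑ a ∈ S, ∑ b ∈ S', A a b * (if g a = g b then 1 else 0)

/-- The summand `S.card` makes scores of nonempty sets positive, so that the initial value `0` of a
cell can mean that no labelling has been found for its key. -/
def score (A : ℕ → ℕ → ℕ) (S : Finset ℕ) (g : ℕ → ℕ) : ℕ := S.card + inner A S S g

/-- The number of vertices in `S` whose label and colour are given by `i`. -/
def cnt (cl : ℕ → ℕ) (S : Finset ℕ) (g : ℕ → ℕ) (i : ℕ) : ℕ :=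
  (S.filter fun v => 2 * g v + cl v = i).card

section

variable {n p : ℕ} {cl : ℕ → ℕ} {A : ℕ → ℕ → ℕ} {S S' : Finset ℕ} {g g' : ℕ → ℕ} {r u v : ℕ}

theorem code_congr (h : ∀ w ∈ S, g w = g' w) : code n cl S g = code n cl S g' :=
  sum_congr rfl fun w hw => by rw [h w hw]

theorem key_congr (hr : r ∈ S) (h : ∀ w ∈ S, g w = g' w) :
    key n cl S g r = key n cl S g' r := by
  rw [key, key, code_congr h, h r hr]

theorem inner_congr (h : ∀ w ∈ S, g w = g' w) (h' : ∀ w ∈ S', g w = g' w) :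
    inner A S S' g = inner A S S' g' :=
  sum_congr rfl fun a ha => sum_congr rfl fun b hb => by rw [h a ha, h' b hb]

theorem score_congr (h : ∀ w ∈ S, g w = g' w) : score A S g = score A S g' := by
  rw [score, score, inner_congr h h]

theorem code_eq_sum_cnt (hg : ∀ v ∈ S, g v < p) (hc : ∀ v, cl v ≤ 1) :
    code n cl S g = ∑ i ∈ range (2 * p), cnt cl S g i * n ^ (i + 1) := by
  rw [code, ← sum_fiberwise_of_maps_to (t := range (2 * p)) (g := fun v => 2 * g v + cl v)]
  · refine sum_congr rfl fun i _ => ?_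
    rw [cnt, ← smul_eq_mul, ← sum_const]
    refine sum_congr rfl fun v hv => ?_
    rw [(mem_filter.1 hv).2]
  · intro v hv
    have := hg v hv
    have := hc v
    rw [mem_range]
    omega

/-- Each of the two colours has fewer than `n` vertices. -/
def BothColours (n : ℕ) (cl : ℕ → ℕ) : Prop :=
  (∀ v, cl v ≤ 1) ∧ ∀ i, ((range n).filter fun v => cl v = i).card < n

/-- The parity of `i` is the colour of all vertices counted, and no colour is shared by all `n`
vertices. Without this, counts would not be digits in base `n`. -/
theorem cnt_lt (hcl : BothColours n cl) (hS : S ⊆ range n) (i : ℕ) : cnt cl S g i < n := by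
  refine lt_of_le_of_lt (card_le_card (t := (range n).filter fun v => cl v = i % 2) ?_)
    (hcl.2 _)
  intro v hv
  rw [mem_filter] at hv ⊢
  have := hcl.1 v
  exact ⟨hS hv.1, by omega⟩

theorem key_eq_sum (hg : ∀ v ∈ S, g v < p) (hc : ∀ v, cl v ≤ 1) :
    key n cl S g r =
      ∑ i ∈ range (2 * p + 1), (if i = 0 then g r else cnt cl S g (i - 1)) * n ^ i := by
  rw [key, code_eq_sum_cnt hg hc, sum_range_succ']
  simp

theorem digit_lt (hcl : BothColours n cl) (hS : S ⊆ range n) (hg : g r < n) (i : ℕ) :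
    (if i = 0 then g r else cnt cl S g (i - 1)) < n := by
  split_ifs
  · exact hg
  · exact cnt_lt hcl hS _

theorem key_lt (hcl : BothColours n cl) (hS : S ⊆ range n) (hr : r ∈ S) (hpn : p ≤ n)
    (hg : ∀ v ∈ S, g v < p) : key n cl S g r < n ^ (2 * p + 1) := by
  rw [key_eq_sum hg hcl.1]
  exact sum_digits_lt fun i _ => digit_lt hcl hS ((hg r hr).trans_le hpn) i

theorem key_digit (hcl : BothColours n cl) (hS : S ⊆ range n) (hr : r ∈ S) (hpn : p ≤ n)
    (hg : ∀ v ∈ S, g v < p) {i : ℕ} (hi : i < 2 * p) :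
    key n cl S g r / n ^ (i + 1) % n = cnt cl S g i := by
  rw [key_eq_sum hg hcl.1, sum_digits_div_mod (by omega)
    fun i _ => digit_lt hcl hS ((hg r hr).trans_le hpn) i]
  simp

/-- All exponents in `code` are positive, so the lowest digit is free for the label of the root. -/
theorem key_mod (hg : g r < n) : key n cl S g r % n = g r := by
  have h : n ∣ code n cl S g := dvd_sum fun v _ => dvd_pow_self _ (by omega)
  obtain ⟨m, hm⟩ := h
  rw [key, hm, Nat.mul_add_mod, Nat.mod_eq_of_lt hg]

/-- Codes are additive over disjoint sets. The root digit of `S'` is dropped, since only `v` remains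
a root. -/
theorem key_union (hd : Disjoint S S') (hg : g u < n) :
    key n cl (S ∪ S') g v =
      key n cl S g v + (key n cl S' g u - key n cl S' g u % n) := by
  rw [key_mod hg, key, key, key, Nat.add_sub_cancel, code, sum_union hd, code, code]
  omega

theorem inner_single (hv : v ∈ S) (hu : u ∈ S')
    (hA : ∀ a ∈ S, ∀ b ∈ S', A a b ≠ 0 → a = v ∧ b = u) :
    inner A S S' g = A v u * (if g v = g u then 1 else 0) := by
  rw [inner, sum_eq_single v, sum_eq_single u]
  · intro b hb hbu
    by_cases h : A v b = 0
    · simp [h]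
    · exact absurd (hA v hv b hb h).2 hbu
  · exact fun h => absurd hu h
  · intro a ha hav
    refine sum_eq_zero fun b hb => ?_
    by_cases h : A a b = 0
    · simp [h]
    · exact absurd (hA a ha b hb h).1 hav
  · exact fun h => absurd hv h

/-- The only edge that can join the two sets is `v u`; it is counted in both orders, hence the
factor 2. -/
theorem score_union (hs : ∀ a b, A a b = A b a) (hd : Disjoint S S') (hv : v ∈ S) (hu : u ∈ S')
    (hA : ∀ a ∈ S, ∀ b ∈ S', A a b ≠ 0 → a = v ∧ b = u) :
    score A (S ∪ S') g =
      score A S g + score A S' g + 2 * (A v u * (if g v = g u then 1 else 0)) := by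
  have h1 := inner_single (g := g) hv hu hA
  have h2 := inner_single (g := g) (A := A) hu hv
    fun a ha b hb h => (hA b hb a ha (by rwa [hs])).symm
  rw [hs u v] at h2
  simp only [eq_comm (a := g u)] at h2
  have h3 : inner A (S ∪ S') (S ∪ S') g =
      inner A S S g + inner A S S' g + (inner A S' S g + inner A S' S' g) := by
    simp only [inner, sum_union hd, sum_add_distrib]
  rw [score, score, score, card_union_of_disjoint hd, h3, h1, h2]
  ring

theorem score_pos (hr : r ∈ S) : 0 < score A S g := by
  have := card_pos.2 ⟨r, hr⟩
  rw [score]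
  omega

theorem score_le (hA : ∀ a b, A a b ≤ 1) (hS : S ⊆ range n) : score A S g ≤ n + n * n := by
  have hc : S.card ≤ n := by simpa using card_le_card hS
  have h : inner A S S g ≤ S.card * S.card := by
    rw [inner, ← smul_eq_mul]
    refine sum_le_card_nsmul _ _ _ fun a _ => ?_
    refine (sum_le_card_nsmul _ _ 1 fun b _ => ?_).trans (by simp)
    have := hA a b
    split_ifs <;> omega
  have := Nat.mul_le_mul hc hc
  rw [score]
  omega

end


theorem State.write_ne {s : State} {a a' i x : ℕ} (h : a' ≠ a) : s.write a i x a' = s a' := by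
  funext j
  simp [State.write, h]

/-! ### Total correctness of programs with bounded memory -/

namespace Expr

/-- The value of an expression is a polynomial in the words it reads; `deg` bounds its degree. -/
def deg : Expr → ℕ
  | lit _ => 0
  | get _ _ => 1
  | op .add x y => max x.deg y.deg
  | op .mul x y => x.deg + y.deg
  | op .lt _ _ => 0
  | op .eq _ _ => 0
  | op _ x _ => x.deg

/-- The value of an expression is at most `coef * B ^ deg` if all words read are below `B`. -/
def coef : Expr → ℕ
  | lit k => k + 1
  | get _ _ => 1
  | op .add x y => x.coef + y.coef
  | op .mul x y => x.coef * y.coef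
  | op .lt _ _ => 1
  | op .eq _ _ => 1
  | op _ x _ => x.coef

/-- All subexpressions are quadratic with small coefficients. -/
def ok : Expr → Bool
  | lit k => decide (k < 16)
  | get _ i => i.ok
  | op o x y => x.ok && y.ok && decide ((op o x y).deg ≤ 2) && decide ((op o x y).coef ≤ 16)

theorem eval_le {B : ℕ} {s : State} (hs : ∀ a i, s a i < B) (e : Expr) :
    e.eval s ≤ e.coef * B ^ e.deg := by
  have hB : 0 < B := (Nat.zero_le _).trans_lt (hs 0 0)
  induction e with
  | lit k => simp [eval, coef, deg]
  | get a i => simpa [eval, coef, deg] using (hs a (i.eval s)).le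
  | op o x y hx hy =>
    cases o with
    | add =>
      simp only [eval, Op.eval, coef, deg, add_mul]
      exact Nat.add_le_add
        (hx.trans (Nat.mul_le_mul_left _ (Nat.pow_le_pow_right hB (le_max_left _ _))))
        (hy.trans (Nat.mul_le_mul_left _ (Nat.pow_le_pow_right hB (le_max_right _ _))))
    | sub => exact (Nat.sub_le _ _).trans hx
    | mul =>
      simp only [eval, Op.eval, coef, deg, pow_add]
      calc _ ≤ _ := Nat.mul_le_mul hx hy
        _ = _ := by ring
    | div => exact (Nat.div_le_self _ _).trans hx
    | mod => exact (Nat.mod_le _ _).trans hx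
    | lt => simp only [eval, Op.eval, coef, deg]; split_ifs <;> simp
    | eq => simp only [eval, Op.eval, coef, deg]; split_ifs <;> simp

/-- `ok` depends on the expression alone, not on the memory, so absence of overflow can be settled
by `decide` for every expression of the program. -/
theorem fits_of_ok {B W : ℕ} {s : State} (hs : ∀ a i, s a i < B) (hW : 16 * B ^ 2 < W)
    (e : Expr) (he : e.ok = true) : e.Fits W s := by
  have hB : 0 < B := (Nat.zero_le _).trans_lt (hs 0 0)
  have hB2 : B ≤ B ^ 2 := Nat.le_self_pow (by omega) B
  induction e with
  | lit k => simp only [ok, decide_eq_true_eq] at he; simp only [Fits]; omega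
  | get a i hi => exact ⟨hi he, by have := hs a (i.eval s); omega⟩
  | op o x y hx hy =>
    simp only [ok, Bool.and_eq_true, decide_eq_true_eq] at he
    refine ⟨hx he.1.1.1, hy he.1.1.2, lt_of_le_of_lt ?_ hW⟩
    exact (eval_le hs (.op o x y)).trans
      (Nat.mul_le_mul he.2 (Nat.pow_le_pow_right hB he.1.2))

end Expr

namespace Prog

/-- The arrays that a program may write to. -/
def mods : Prog → List ℕ
  | skip => []
  | set a _ _ => [a]
  | seq q r => q.mods ++ r.mods
  | ite _ q r => q.mods ++ r.mods
  | .while _ q => q.mods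

end Prog

/-- Since `mods` is computed from the program text, `decide` can show which arrays a phase leaves
untouched. -/
theorem Exec.frame {W : ℕ} {q : Prog} {s s' : State} {t : ℕ} (h : Exec W q s s' t) {a : ℕ}
    (ha : a ∉ q.mods) : s' a = s a := by
  induction h with
  | skip s => rfl
  | set b i x s hi hx =>
    simp only [Prog.mods, List.mem_singleton] at ha
    funext j
    simp [State.write, ha]
  | seq hq hr h1 h2 =>
    simp only [Prog.mods, List.mem_append, not_or] at ha
    rw [h2 ha.2, h1 ha.1]
  | ite_true hb hne hq h1 =>
    simp only [Prog.mods, List.mem_append, not_or] at ha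
    exact h1 ha.1
  | ite_false hb hne hq h1 =>
    simp only [Prog.mods, List.mem_append, not_or] at ha
    exact h1 ha.2
  | while_false hb h0 => rfl
  | while_true hb hne hq hw h1 h2 => rw [h2 ha, h1 ha]

/-- Started in `s`, all of whose words are below `B`, the program halts within `T` steps in a
memory with the same bound that satisfies `Q`. -/
def Run (W B : ℕ) (q : Prog) (s : State) (T : ℕ) (Q : State → Prop) : Prop :=
  (∀ a i, s a i < B) →
    ∃ s' t, Exec W q s s' t ∧ t ≤ T ∧ (∀ a i, s' a i < B) ∧ (∀ a ∉ q.mods, s' a = s a) ∧ Q s'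

/-! ### Proof rules for runs with bounded time and memory words. -/

namespace Run

variable {W B T T' T₁ T₂ : ℕ} {q r : Prog} {s : State} {Q R : State → Prop} {b : Expr}

theorem mono (h : Run W B q s T Q) (hT : T ≤ T')
    (hQ : ∀ s', (∀ a ∉ q.mods, s' a = s a) → Q s' → R s') : Run W B q s T' R := by
  intro hs
  obtain ⟨s', t, h1, h2, h3, h4, h5⟩ := h hs
  exact ⟨s', t, h1, h2.trans hT, h3, h4, hQ s' h4 h5⟩

theorem skip (h : Q s) (hT : 1 ≤ T) : Run W B .skip s T Q :=
  fun hs => ⟨s, 1, .skip s, hT, hs, by simp, h⟩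

/-- The number 50 is a uniform allowance for one assignment or one test with short expressions; it
replaces exact step counts throughout. -/
theorem set {a : ℕ} {i x : Expr} (hW : 16 * B ^ 2 < W) (hok : (i.ok && x.ok) = true)
    (hst : i.steps + x.steps < 50) (hx : x.eval s < B) (hT : 50 ≤ T)
    (h : Q (s.write a (i.eval s) (x.eval s))) : Run W B (.set a i x) s T Q := by
  intro hs
  rw [Bool.and_eq_true] at hok
  have he := Exec.set a i x s (i.fits_of_ok hs hW hok.1) (x.fits_of_ok hs hW hok.2)
  refine ⟨_, _, he, by omega, ?_, fun a ha => he.frame ha, h⟩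
  intro a' i'
  rw [State.write]
  split_ifs
  · exact hx
  · exact hs a' i'

theorem seq (hq : Run W B q s T₁ R)
    (hr : ∀ s', (∀ a ∉ q.mods, s' a = s a) → R s' → Run W B r s' T₂ Q) :
    Run W B (.seq q r) s (T₁ + T₂) Q := by
  intro hs
  obtain ⟨s', t, h1, h2, h3, h4, h5⟩ := hq hs
  obtain ⟨s'', t', k1, k2, k3, k4, k5⟩ := hr s' h4 h5 h3
  have he := Exec.seq h1 k1
  exact ⟨s'', _, he, by omega, k3, fun a ha => he.frame ha, k5⟩

theorem set_seq {a : ℕ} {i x : Expr} (hW : 16 * B ^ 2 < W) (hok : (i.ok && x.ok) = true)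
    (hst : i.steps + x.steps < 50) (hx : x.eval s < B) (hT : 50 ≤ T)
    (h : Run W B r (s.write a (i.eval s) (x.eval s)) (T - 50) Q) :
    Run W B (.seq (.set a i x) r) s T Q := by
  refine mono (T := 50 + (T - 50)) (seq (R := fun s' => s' = s.write a (i.eval s) (x.eval s))
    (set hW hok hst hx le_rfl rfl) fun s' _ hs' => ?_) (by omega) fun _ _ h => h
  rw [hs']
  exact h

theorem ite (hW : 16 * B ^ 2 < W) (hok : b.ok = true) (hst : b.steps < 50) (hT : 50 ≤ T)
    (h1 : b.eval s ≠ 0 → Run W B q s (T - 50) Q)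
    (h0 : b.eval s = 0 → Run W B r s (T - 50) Q) :
    Run W B (.ite b q r) s T Q := by
  intro hs
  by_cases hb : b.eval s = 0
  · obtain ⟨s', t, k1, k2, k3, k4, k5⟩ := h0 hb hs
    have he := Exec.ite_false (q := q) (b.fits_of_ok hs hW hok) hb k1
    exact ⟨s', _, he, by omega, k3, fun a ha => he.frame ha, k5⟩
  · obtain ⟨s', t, k1, k2, k3, k4, k5⟩ := h1 hb hs
    have he := Exec.ite_true (r := r) (b.fits_of_ok hs hW hok) hb k1
    exact ⟨s', _, he, by omega, k3, fun a ha => he.frame ha, k5⟩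

end Run

/-- The value of the scalar variable `a`, which is kept in cell `0` of array `a`. -/
abbrev V (a : ℕ) : Expr := .get a (.lit 0)

/-- The loop `for c < b do q`. -/
def Prog.forLoop (c : ℕ) (b : Expr) (q : Prog) : Prog :=
  .seq (.set c (.lit 0) (.lit 0))
    (.while (.op .lt (V c) b) (.seq q (.set c (.lit 0) (.op .add (V c) (.lit 1)))))

theorem Prog.mem_mods_forLoop {c a : ℕ} {b : Expr} {q : Prog} :
    a ∈ (Prog.forLoop c b q).mods ↔ a = c ∨ a ∈ q.mods := by
  simp only [Prog.forLoop, Prog.mods, List.mem_append, List.mem_singleton]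
  tauto

/-- `I j` speaks about the memory in which the counter already holds `j`; therefore the body has to
preserve the counter and to establish `I (j + 1)` for the memory after the increment. The loop bound
is evaluated anew in each round, so it must have the value `N` in every memory that differs from `s`
only in arrays written by the loop. The summand 100 pays for test and increment. -/
theorem Run.forLoop {W B N T T' : ℕ} {c : ℕ} {b : Expr} {q : Prog} {s : State}
    (I : ℕ → State → Prop) (hW : 16 * B ^ 2 < W) (hok : b.ok = true) (hst : b.steps < 50)
    (hN : N < B) (hT : N * (T + 100) + 200 ≤ T')
    (hb : ∀ s', (∀ a, a ≠ c → a ∉ q.mods → s' a = s a) → b.eval s' = N)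
    (h0 : I 0 (s.write c 0 0))
    (hstep : ∀ j < N, ∀ s', (∀ a, a ≠ c → a ∉ q.mods → s' a = s a) → s' c 0 = j → I j s' →
      Run W B q s' T (fun s'' => s'' c 0 = j ∧ I (j + 1) (s''.write c 0 (j + 1)))) :
    Run W B (Prog.forLoop c b q) s T' (I N) := by
  have hokc : (Expr.op .lt (V c) b).ok = true := by
    simp [Expr.ok, Expr.deg, Expr.coef, hok]
  -- Induction on the number `d` of remaining rounds.
  have key : ∀ d j, j + d = N → ∀ s', (∀ a, a ≠ c → a ∉ q.mods → s' a = s a) → s' c 0 = j →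
      I j s' → Run W B (.while (.op .lt (V c) b)
        (.seq q (.set c (.lit 0) (.op .add (V c) (.lit 1))))) s'
        (d * (T + b.steps + 10) + b.steps + 4) (I N) := by
    intro d
    induction d with
    | zero =>
      intro j hj s' hf hc hI hs
      have hev : (Expr.op .lt (V c) b).eval s' = 0 := by
        simp only [Expr.eval, Op.eval, hb s' hf, hc]
        rw [if_neg (by omega)]
      have he := Exec.while_false (q := .seq q (.set c (.lit 0) (.op .add (V c) (.lit 1))))
        (Expr.fits_of_ok hs hW _ hokc) hev
      refine ⟨s', _, he, ?_, hs, fun a ha => he.frame ha, ?_⟩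
      · simp only [Expr.steps]; omega
      · obtain rfl : j = N := by omega
        exact hI
    | succ d ih =>
      intro j hj s' hf hc hI hs
      have hev : (Expr.op .lt (V c) b).eval s' ≠ 0 := by
        simp only [Expr.eval, Op.eval, hb s' hf, hc]
        rw [if_pos (by omega)]
        exact one_ne_zero
      obtain ⟨s₀, t₀, l1, l2, l3, l4, l5, l6⟩ := hstep j (by omega) s' hf hc hI hs
      have hv : (Expr.op .add (V c) (.lit 1)).eval s₀ = j + 1 := by
        simp [Expr.eval, Op.eval, l5]
      have hset := Exec.set c (.lit 0) (.op .add (V c) (.lit 1)) s₀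
        (Expr.fits_of_ok l3 hW _ (by simp [Expr.ok]))
        (Expr.fits_of_ok l3 hW _ (by simp [Expr.ok, Expr.deg, Expr.coef]))
      have k1 := Exec.seq l1 hset
      rw [hv] at k1
      have hf1 : ∀ a, a ≠ c → a ∉ q.mods → (s₀.write c ((Expr.lit 0).eval s₀) (j + 1)) a = s a := by
        intro a hac haq
        rw [k1.frame (by simp [Prog.mods, hac, haq]), hf a hac haq]
      obtain ⟨s2, t2, m1, m2, m3, m4, m5⟩ := ih (j + 1) (by omega) _ hf1
        (by simp [State.write, Expr.eval]) l6 (by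
          intro a i
          rw [State.write]
          split_ifs
          · omega
          · exact l3 a i)
      have he := Exec.while_true (Expr.fits_of_ok hs hW _ hokc) hev k1 m1
      refine ⟨s2, _, he, ?_, m3, fun a ha => he.frame ha, m5⟩
      simp only [Expr.steps]
      rw [Nat.succ_mul]
      omega
  have h2 := Nat.mul_le_mul_left N (show T + b.steps + 10 ≤ T + 100 by omega)
  refine Run.set_seq hW (by simp [Expr.ok]) (by simp [Expr.steps]) (by simp [Expr.eval]; omega)
    (by omega) (Run.mono (key N 0 (by omega) _ ?_ (by simp [State.write, Expr.eval]) h0)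
      (by omega) fun _ _ h => h)
  intro a ha _
  funext i
  simp [State.write, ha]


/-! ### The program -/

namespace Expr

instance : Add Expr := ⟨op .add⟩
instance : Sub Expr := ⟨op .sub⟩
instance : Mul Expr := ⟨op .mul⟩
instance : Div Expr := ⟨op .div⟩
instance : Mod Expr := ⟨op .mod⟩

/-- The test `x < y`. -/
def less (x y : Expr) : Expr := op .lt x y

/-- The test `x = y`. -/
def equal (x y : Expr) : Expr := op .eq x y

variable (s : State) (x y : Expr)

@[simp] theorem eval_add : (x + y).eval s = x.eval s + y.eval s := rfl
@[simp] theorem eval_sub : (x - y).eval s = x.eval s - y.eval s := rfl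
@[simp] theorem eval_mul : (x * y).eval s = x.eval s * y.eval s := rfl
@[simp] theorem eval_div : (x / y).eval s = x.eval s / y.eval s := rfl
@[simp] theorem eval_mod : (x % y).eval s = x.eval s % y.eval s := rfl
@[simp] theorem eval_less : (x.less y).eval s = if x.eval s < y.eval s then 1 else 0 := rfl
@[simp] theorem eval_equal : (x.equal y).eval s = if x.eval s = y.eval s then 1 else 0 := rfl
@[simp] theorem eval_lit (k : ℕ) : (lit k).eval s = k := rfl
@[simp] theorem eval_get (a : ℕ) : (get a x).eval s = s a (x.eval s) := rfl

end Expr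

open FairCC.Prog FairCC.Expr

/-- Assignment to a scalar variable. -/
abbrev Prog.assign (a : ℕ) (x : Expr) : Prog := .set a (.lit 0) x

scoped infixr:30 " ;; " => Prog.seq

/-! Cell `0` of array `0` holds the number `n` of vertices and cell `1` the number of edges.
The program uses the following further arrays and variables.
* `5`: the number of vertices of colour `1`; `6`: the number `p` of labels;
* `7`: the powers of `n`; `14`: the number of cells of a table, `n ^ (2 * p + 1)`;
* `8`: the adjacency matrix; `9`: the number of neighbours not yet eliminated;
* `10`: whether the vertex has been eliminated; `11`: the number of the table of the vertex;
* `12`: the scores in the tables; `13`: the labellings in the tables;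
* `15`: the round; `16`, `18`, `19`, `24`, `25`, `26`: loop counters;
* `17`: the vertex to be eliminated and the vertex it is merged into; `31`, `32`: these vertices;
* `20`, `21`, `22`: cells of tables; `23`: a score or an objective value;
* `27`, `28`: unfairness and the sum of the squares of the cluster sizes;
* `29`, `30`: the best objective value and its cell. -/

def countColours : Prog := forLoop 24 (V 0) (.assign 5 (V 5 + .get 1 (V 24)))

def powers : Prog :=
  .set 7 (.lit 0) (.lit 1) ;;
  forLoop 24 (.lit 2 * V 6 + .lit 1) (.set 7 (V 24 + .lit 1) (.get 7 (V 24) * V 0)) ;;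
  .assign 14 (.get 7 (.lit 2 * V 6 + .lit 1))

def readEdges : Prog :=
  forLoop 24 (.get 0 (.lit 1))
    (.set 8 (.get 2 (V 24) * V 0 + .get 3 (V 24)) (.lit 1) ;;
     .set 8 (.get 3 (V 24) * V 0 + .get 2 (V 24)) (.lit 1))

def degrees : Prog :=
  forLoop 31 (V 0) (forLoop 24 (V 0)
    (.set 9 (V 31) (.get 9 (V 31) + .get 8 (V 31 * V 0 + V 24))))

def initTables : Prog :=
  forLoop 31 (V 0)
    (.set 11 (V 31) (V 31) ;;
     forLoop 26 (V 6)
      (.assign 22 (V 31 * V 14 + (.get 7 (.lit 2 * V 26 + .get 1 (V 31) + .lit 1) + V 26)) ;;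
       .set 12 (V 22) (.lit 1) ;;
       .set 13 (V 22 * V 0 + V 31) (V 26)))

def findLeaf : Prog :=
  forLoop 16 (V 0 * V 0)
    -- The number `16` encodes a pair of vertices in base `n`. The test succeeds exactly if the left
    -- side is 0 (both vertices remain, and they differ) and the right side is 1 (the remaining
    -- degree of the first equals its adjacency entry with the second).
    (.ite (.less (.get 10 (V 16 / V 0) + .get 10 (V 16 % V 0) +
            .equal (V 16 / V 0) (V 16 % V 0))
          (.equal (.get 9 (V 16 / V 0)) (.get 8 (V 16))))
      (.assign 17 (V 16)) .skip)

def mergeCells : Prog :=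
  .assign 20 (.get 11 (V 32) * V 14 + V 18) ;;
  .assign 21 (.get 11 (V 31) * V 14 + V 19) ;;
  -- The product is nonzero exactly if both cells are occupied.
  .ite (.get 12 (V 20) * .get 12 (V 21))
    (.assign 22 ((V 0 + V 15) * V 14 + (V 18 + (V 19 - V 19 % V 0))) ;;
     .assign 23 (.get 12 (V 20) + .get 12 (V 21) +
       .lit 2 * (.get 8 (V 32 * V 0 + V 31) * .equal (V 18 % V 0) (V 19 % V 0))) ;;
     .ite (.less (.get 12 (V 22)) (V 23))
      (.set 12 (V 22) (V 23) ;;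
       forLoop 24 (V 0) (.set 13 (V 22 * V 0 + V 24)
        (.get 13 (V 20 * V 0 + V 24) + .get 13 (V 21 * V 0 + V 24))))
      .skip)
    .skip

def mergeTables : Prog := forLoop 18 (V 14) (forLoop 19 (V 14) mergeCells)

def eliminate : Prog :=
  findLeaf ;;
  .assign 31 (V 17 / V 0) ;;
  .assign 32 (V 17 % V 0) ;;
  mergeTables ;;
  .set 11 (V 32) (V 0 + V 15) ;;
  .set 10 (V 31) (.lit 1) ;;
  .set 9 (V 32) (.get 9 (V 32) - .get 8 (V 32 * V 0 + V 31))

def rateCell : Prog :=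
  -- The `n - 1` merges create the tables `n, …, 2 * n - 2`; the last one belongs to the whole
  -- vertex set.
  .assign 22 ((.lit 2 * V 0 - .lit 2) * V 14 + V 25) ;;
  .assign 27 (.lit 0) ;;
  .assign 28 (.lit 0) ;;
  forLoop 26 (V 6)
    (.assign 32 (V 25 / .get 7 (.lit 2 * V 26 + .lit 1) % V 0) ;;
     .assign 31 (V 25 / .get 7 (.lit 2 * V 26 + .lit 2) % V 0) ;;
     -- Counts the labels that violate fairness, tested in cross-multiplied form.
     .assign 27 (V 27 + (.lit 1 - .equal (V 32 * V 5) (V 31 * (V 0 - V 5)))) ;;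
     .assign 28 (V 28 + (V 32 + V 31) * (V 32 + V 31))) ;;
  -- The summand `n * n` prevents truncation for counts that come from a labelling. For an empty
  -- cell the value is meaningless, and the next test rejects it.
  .assign 23 (V 0 * V 0 + .lit 2 * .get 12 (V 22) - V 28) ;;
  .ite (.equal (V 27) (.lit 0) * .less (.lit 0) (.get 12 (V 22)) * .less (V 29) (V 23))
    (.assign 29 (V 23) ;; .assign 30 (V 22)) .skip

def findBest : Prog := forLoop 25 (V 14) rateCell

def output : Prog := forLoop 24 (V 0) (.set 4 (V 24) (.get 13 (V 30 * V 0 + V 24)))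

def dynamicProgram : Prog :=
  powers ;; readEdges ;; degrees ;; initTables ;;
  forLoop 15 (V 0 - .lit 1) eliminate ;; findBest ;; output

def solver : Prog :=
  countColours ;;
  .ite (.less (V 5) (V 0 - V 5)) (.assign 6 (V 5)) (.assign 6 (V 0 - V 5)) ;;
  -- For `p ≤ 1` array `4` stays zero, which is the output of a single cluster.
  .ite (.less (.lit 1) (V 6)) dynamicProgram .skip

/-! ### Preparation -/

section

variable {W B n p m K : ℕ} {s : State} {cl : ℕ → ℕ} {A : ℕ → ℕ → ℕ}

theorem countColours_run (hW : 16 * B ^ 2 < W) (hn : s 0 0 = n) (hnB : n < B)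
    (h5 : s 5 0 = 0) (hcl : ∀ v < n, s 1 v = cl v) (hcl1 : ∀ v, cl v ≤ 1) :
    Run W B countColours s (n * 200 + 200) (fun s' => s' 5 0 = ∑ v ∈ range n, cl v) := by
  refine Run.forLoop (N := n) (T := 50) (fun j s' => s' 5 0 = ∑ v ∈ range j, cl v) hW
    (by decide) (by decide) hnB (by omega) ?_ ?_ ?_
  · intro s' hf
    simp [hf 0 (by decide) (by decide), hn]
  · simp [State.write, h5]
  · intro j hj s' hf hc hI
    have e1 := hf 1 (by decide) (by decide)
    have h1 : ∑ v ∈ range (j + 1), cl v ≤ (j + 1) * 1 := by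
      simpa using sum_le_card_nsmul (range (j + 1)) cl 1 fun v _ => hcl1 v
    rw [sum_range_succ] at h1
    refine Run.set hW (by decide) (by decide) ?_ (by omega) ?_
    · simp [hc, hI, e1, hcl j hj]
      omega
    · simp [State.write, hc, hI, e1, hcl j hj, sum_range_succ]

theorem powers_run (hW : 16 * B ^ 2 < W) (hn : s 0 0 = n) (hp : s 6 0 = p) (hn2 : 2 ≤ n)
    (hB : n ^ (2 * p + 1) < B) :
    Run W B powers s ((2 * p + 1) * 200 + 500) (fun s' =>
      (∀ i ≤ 2 * p + 1, s' 7 i = n ^ i) ∧ s' 14 0 = n ^ (2 * p + 1)) := by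
  have hle : 2 * p + 1 < n ^ (2 * p + 1) := Nat.lt_pow_self (by omega)
  refine Run.set_seq hW (by decide) (by decide) (by simp; omega) (by omega) ?_
  refine Run.mono (T := ((2 * p + 1) * 200 + 300) + 50) ?_ (by omega) fun _ _ h => h
  refine Run.seq (Run.forLoop (N := 2 * p + 1) (T := 50)
    (fun j s' => ∀ i ≤ j, s' 7 i = n ^ i) hW
    (by decide) (by decide) (by omega) (by omega) ?_ ?_ ?_) ?_
  · intro s' hf
    simp [hf 6 (by decide) (by decide), hp, State.write]
  · simp [State.write]
  · intro j hj s' hf hc hI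
    have e0 := hf 0 (by decide) (by decide)
    have hlt : n ^ j * n < B := by
      rw [← pow_succ]
      exact (Nat.pow_le_pow_right (by omega) (by omega)).trans_lt hB
    have en : s' 0 0 = n := by rw [e0]; simpa [State.write] using hn
    refine Run.set hW (by decide) (by decide) ?_ (by omega) ⟨by simp [State.write, hc], ?_⟩
    · simpa [hc, hI j le_rfl, en] using hlt
    · intro i hi
      rcases Nat.lt_or_ge j i with h | h
      · obtain rfl : i = j + 1 := by omega
        simp [State.write, hc, hI j le_rfl, en, pow_succ]
      · simp [State.write, hc, hI i h, show i ≠ j + 1 by omega]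
  · intro s' hf hI
    have e6 := hf 6 (by decide)
    have ep : s' 6 0 = p := by rw [e6]; simpa [State.write] using hp
    refine Run.set hW (by decide) (by decide) ?_ (by omega) ⟨?_, ?_⟩
    · simpa [ep, hI _ le_rfl] using hB
    · intro i hi
      simpa [State.write] using hI i hi
    · simp [State.write, ep, hI _ le_rfl]

/-! ### Addresses in two-dimensional arrays. -/

theorem mul_add_inj {a b a' b' n : ℕ} (hb : b < n) (hb' : b' < n) :
    a * n + b = a' * n + b' ↔ a = a' ∧ b = b' := by
  refine ⟨fun h => ?_, fun h => by rw [h.1, h.2]⟩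
  have h1 := congrArg (· / n) h
  have h2 := congrArg (· % n) h
  simp only [mul_comm _ n, Nat.mul_add_div (show 0 < n by omega), Nat.div_eq_of_lt hb,
    Nat.div_eq_of_lt hb', Nat.mul_add_mod, Nat.mod_eq_of_lt hb, Nat.mod_eq_of_lt hb'] at h1 h2
  exact ⟨by omega, h2⟩

theorem mul_add_lt {a b a' n : ℕ} (ha : a < a') (hb : b < n) : a * n + b < a' * n := by
  have := Nat.mul_le_mul_right n (show a + 1 ≤ a' from ha)
  rw [Nat.succ_mul] at this
  omega

theorem readEdges_run (hW : 16 * B ^ 2 < W) (hn : s 0 0 = n) (hm : s 0 1 = m) (hmB : m < B)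
    (hB : 1 < B) (h8 : ∀ x, s 8 x = 0) (hE : ∀ i < m, s 2 i < n ∧ s 3 i < n)
    (hA : ∀ a b, A a b = 0 ∨ A a b = 1)
    (hA1 : ∀ a b, A a b = 1 ↔
      ∃ i < m, (s 2 i = a ∧ s 3 i = b) ∨ (s 3 i = a ∧ s 2 i = b)) :
    Run W B readEdges s (m * 200 + 200)
      (fun s' => ∀ a < n, ∀ b < n, s' 8 (a * n + b) = A a b) := by
  classical
  refine Run.mono (Run.forLoop (N := m) (T := 100) (fun j s' => ∀ a < n, ∀ b < n,
    s' 8 (a * n + b) =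
      if ∃ i < j, (s 2 i = a ∧ s 3 i = b) ∨ (s 3 i = a ∧ s 2 i = b) then 1 else 0) hW
    (by decide) (by decide) hmB le_rfl ?_ ?_ ?_) le_rfl ?_
  · intro s' hf
    simp [hf 0 (by decide) (by decide), hm]
  · intro a _ b _
    simp [State.write, h8]
  · intro j hj s' hf hc hI
    have e0 := hf 0 (by decide) (by decide)
    have e2 := hf 2 (by decide) (by decide)
    have e3 := hf 3 (by decide) (by decide)
    obtain ⟨hj2, hj3⟩ := hE j hj
    refine Run.set_seq hW (by decide) (by decide) (by simpa using hB) (by omega) ?_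
    refine Run.set hW (by decide) (by decide) (by simpa using hB) (by omega) ⟨?_, ?_⟩
    · simp [State.write, hc]
    · intro a ha b hb
      have key : (∃ i < j + 1, (s 2 i = a ∧ s 3 i = b) ∨ (s 3 i = a ∧ s 2 i = b)) ↔
          (∃ i < j, (s 2 i = a ∧ s 3 i = b) ∨ (s 3 i = a ∧ s 2 i = b)) ∨
          (a = s 3 j ∧ b = s 2 j) ∨ (a = s 2 j ∧ b = s 3 j) := by
        constructor
        · rintro ⟨i, hi, h⟩
          rcases Nat.lt_or_ge i j with h' | h'
          · exact Or.inl ⟨i, h', h⟩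
          · obtain rfl : i = j := by omega
            right; omega
        · rintro (⟨i, hi, h⟩ | h)
          · exact ⟨i, by omega, h⟩
          · exact ⟨j, by omega, by omega⟩
      simp only [State.write, eval_add, eval_mul, eval_get, eval_lit, hc, e0, e2, e3, hn,
        mul_add_inj hb hj3, hI a ha b hb, key]
      by_cases h1 : a = s 3 j ∧ b = s 2 j
      · simp [h1]
      · by_cases h2 : a = s 2 j ∧ b = s 3 j
        · simp [h2]
        · simp [h1, h2, mul_add_inj hb hj2]
  · intro s' _ h a ha b hb
    rw [h a ha b hb]
    rcases hA a b with h' | h'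
    · rw [if_neg fun hh => by rw [(hA1 a b).2 hh] at h'; omega, h']
    · rw [if_pos ((hA1 a b).1 h'), h']

theorem degrees_run (hW : 16 * B ^ 2 < W) (hn : s 0 0 = n) (hnB : n < B)
    (h9 : ∀ x, s 9 x = 0) (hA : ∀ a b, A a b ≤ 1)
    (h8 : ∀ a < n, ∀ b < n, s 8 (a * n + b) = A a b) :
    Run W B degrees s (n * (n * 200 + 300) + 200)
      (fun s' => ∀ a < n, s' 9 a = ∑ b ∈ range n, A a b) := by
  refine Run.mono (Run.forLoop (N := n) (T := n * 200 + 200) (fun j s' => ∀ a < n,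
    s' 9 a = if a < j then ∑ b ∈ range n, A a b else 0) hW
    (by decide) (by decide) hnB (le_of_eq (by ring)) ?_ ?_ ?_) le_rfl ?_
  · intro s' hf
    simp [hf 0 (by decide) (by decide), hn]
  · intro a _
    simp [State.write, h9]
  · intro j hj s' hf hc hI
    refine Run.mono (Run.forLoop (N := n) (T := 50) (fun i s'' => ∀ a < n,
      s'' 9 a = if a < j then ∑ b ∈ range n, A a b else
        if a = j then ∑ b ∈ range i, A a b else 0) hW
      (by decide) (by decide) hnB (by omega) ?_ ?_ ?_) le_rfl ?_
    · intro s'' hf'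
      simp [hf' 0 (by decide) (by decide), hf 0 (by decide) (by decide), hn]
    · intro a ha
      simp [State.write, hI a ha]
    · intro i hi s'' hf' hc' hI'
      have e0 : s'' 0 0 = n := by
        rw [hf' 0 (by decide) (by decide), hf 0 (by decide) (by decide), hn]
      have e8 : s'' 8 = s 8 := by
        rw [hf' 8 (by decide) (by decide), hf 8 (by decide) (by decide)]
      have ej : s'' 31 0 = j := by rw [hf' 31 (by decide) (by decide), hc]
      have hv : s'' 9 j + s'' 8 (j * n + i) = ∑ b ∈ range (i + 1), A j b := by
        rw [hI' j hj, e8, h8 j hj i hi, sum_range_succ]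
        simp
      have h1 : ∑ v ∈ range (i + 1), A j v ≤ (i + 1) * 1 := by
        simpa using sum_le_card_nsmul (range (i + 1)) (A j) 1 fun v _ => hA j v
      refine Run.set hW (by decide) (by decide) ?_ (by omega) ⟨by simp [State.write, hc'], ?_⟩
      · simp only [eval_add, eval_mul, eval_get, eval_lit, ej, e0, hc', hv]
        omega
      · intro a ha
        simp only [State.write, eval_add, eval_mul, eval_get, eval_lit, ej, e0, hc', hv]
        by_cases h : a = j
        · simp [h]
        · simp [h, hI' a ha]
    · intro s'' hf' h
      refine ⟨by rw [hf' 31 (by decide), hc], ?_⟩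
      intro a ha
      simp only [State.write]
      rw [if_neg (by simp), h a ha]
      split_ifs <;> omega
  · intro s' _ h a ha
    rw [h a ha, if_pos ha]

end


/-! ### Tables -/

/-- The labelling stored in row `e`. -/
def row (n : ℕ) (lab : ℕ → ℕ) (e : ℕ) : ℕ → ℕ := fun w => lab (e * n + w)

/-- Table `t` holds, for each key, the maximum score of a labelling of `S` with this key, and a
labelling attaining it. -/
structure Table (n p K : ℕ) (cl : ℕ → ℕ) (A : ℕ → ℕ → ℕ) (sc lab : ℕ → ℕ) (t : ℕ)
    (S : Finset ℕ) (r : ℕ) : Prop where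
  sound : ∀ k < K, sc (t * K + k) ≠ 0 →
    (∀ w ∈ S, row n lab (t * K + k) w < p) ∧
    (∀ w < n, w ∉ S → row n lab (t * K + k) w = 0) ∧
    key n cl S (row n lab (t * K + k)) r = k ∧
    score A S (row n lab (t * K + k)) = sc (t * K + k)
  complete : ∀ g : ℕ → ℕ, (∀ w ∈ S, g w < p) →
    score A S g ≤ sc (t * K + key n cl S g r)

section

variable {W B n p m K : ℕ} {s : State} {cl : ℕ → ℕ} {A : ℕ → ℕ → ℕ}

/-- All data of table `t` lies below the end of block `t`, so later tables do not disturb it. -/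
theorem Table.congr {sc lab sc' lab' : ℕ → ℕ} {t r : ℕ} {S : Finset ℕ}
    (h : Table n p K cl A sc lab t S r) (hS : S ⊆ range n)
    (hK : ∀ g : ℕ → ℕ, (∀ w ∈ S, g w < p) → key n cl S g r < K) (hr : r ∈ S)
    (h1 : ∀ x < (t + 1) * K, sc' x = sc x)
    (h2 : ∀ x < (t + 1) * K * n, lab' x = lab x) : Table n p K cl A sc' lab' t S r := by
  have hrow : ∀ k < K, ∀ w < n, row n lab' (t * K + k) w = row n lab (t * K + k) w := by
    intro k hk w hw
    exact h2 _ (mul_add_lt (mul_add_lt (Nat.lt_succ_self t) hk) hw)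
  have hlt : ∀ k < K, t * K + k < (t + 1) * K := fun k hk => mul_add_lt (Nat.lt_succ_self t) hk
  constructor
  · intro k hk hne
    rw [h1 _ (hlt k hk)] at hne ⊢
    obtain ⟨a1, a2, a3, a4⟩ := h.sound k hk hne
    have hS' : ∀ w ∈ S, row n lab' (t * K + k) w = row n lab (t * K + k) w :=
      fun w hw => hrow k hk w (mem_range.1 (hS hw))
    exact ⟨fun w hw => by rw [hS' w hw]; exact a1 w hw,
      fun w hw hw' => by rw [hrow k hk w hw]; exact a2 w hw hw',
      by rw [key_congr hr hS']; exact a3, by rw [score_congr hS']; exact a4⟩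
  · intro g hg
    rw [h1 _ (hlt _ (hK g hg))]
    exact h.complete g hg

theorem initTables_run (hW : 16 * B ^ 2 < W) (hn : s 0 0 = n) (hp : s 6 0 = p)
    (hK : s 14 0 = K) (hKn : K = n ^ (2 * p + 1)) (hpn : p ≤ n) (hn0 : 0 < n)
    (hB : n * K < B) (hcl : ∀ v < n, s 1 v = cl v) (hcl1 : BothColours n cl)
    (h7 : ∀ i ≤ 2 * p + 1, s 7 i = n ^ i) (h12 : ∀ x, s 12 x = 0) (h13 : ∀ x, s 13 x = 0)
    (hA : ∀ v, A v v = 0) :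
    Run W B initTables s (n * (p * 300 + 500) + 200) (fun s' =>
      (∀ v < n, s' 11 v = v ∧ Table n p K cl A (s' 12) (s' 13) v {v} v) ∧
      ∀ x, n * K ≤ x → s' 12 x = 0) := by
  have hK0 : 0 < K := by rw [hKn]; positivity
  have hnB : n < B := lt_of_le_of_lt (Nat.le_mul_of_pos_right _ hK0) hB
  -- The cell, in block `u`, of the key of the labelling of `{u}` by `l`.
  let E : ℕ → ℕ → ℕ := fun u l => u * K + (n ^ (2 * l + cl u + 1) + l)
  have hkey : ∀ u (g : ℕ → ℕ), key n cl {u} g u = n ^ (2 * g u + cl u + 1) + g u := by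
    intro u g
    simp [key, code]
  have hkK : ∀ u < n, ∀ l < p, n ^ (2 * l + cl u + 1) + l < K := by
    intro u hu l hl
    rw [hKn, ← hkey u fun _ => l]
    exact key_lt hcl1 (by simpa using hu) (by simp) hpn (by simpa using hl)
  -- The other two summands of the address are multiples of `n`, so a cell determines its label and
  -- different labels do not overwrite each other.
  have hEmod : ∀ u, ∀ l < p, E u l % n = l := by
    intro u l hl
    have : E u l = n * (u * n ^ (2 * p) + n ^ (2 * l + cl u)) + l := by
      simp only [E, hKn]
      ring
    rw [this, Nat.mul_add_mod, Nat.mod_eq_of_lt (by omega)]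
  have hElt : ∀ u < n, ∀ l < p, E u l < n * K := fun u hu l hl =>
    mul_add_lt hu (hkK u hu l hl)
  -- the invariant for a set `D` of pairs that have been dealt with
  let J : (ℕ → ℕ → Prop) → State → Prop := fun D s' =>
    (∀ u < n, ∀ l < p, D u l → s' 12 (E u l) = 1 ∧ s' 13 (E u l * n + u) = l) ∧
    -- Nothing else is nonzero: unused cells are recognisable, and rows vanish outside their own
    -- vertex set, as merging requires.
    (∀ x, s' 12 x ≠ 0 → ∃ u < n, ∃ l < p, x = E u l) ∧
    (∀ y, s' 13 y ≠ 0 → ∃ u < n, ∃ l < p, y = E u l * n + u)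
  have hJ : ∀ {D D' : ℕ → ℕ → Prop} {s1 s2 : State}, J D s1 → s1 12 = s2 12 → s1 13 = s2 13 →
      (∀ u < n, ∀ l < p, D' u l → D u l) → J D' s2 := by
    intro D D' s1 s2 h e1 e2 h'
    simp only [J, ← e1, ← e2]
    exact ⟨fun u hu l hl hD => h.1 u hu l hl (h' u hu l hl hD), h.2⟩
  refine Run.mono (Run.forLoop (N := n) (T := p * 300 + 400) (fun j s' =>
    (∀ v < j, s' 11 v = v) ∧ J (fun u _ => u < j) s') hW
    (by decide) (by decide) hnB (le_of_eq (by ring)) ?_ ?_ ?_) le_rfl ?_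
  · intro s' hf
    simp [hf 0 (by decide) (by decide), hn]
  · refine ⟨fun v hv => by omega, fun u _ l _ h => absurd h (Nat.not_lt_zero _), ?_, ?_⟩
    · intro x hx
      simp [State.write, h12] at hx
    · intro x hx
      simp [State.write, h13] at hx
  · intro j hj s' hf hc hI
    refine Run.set_seq hW (by decide) (by decide) (by simp [hc]; omega) (by omega) ?_
    refine Run.mono (Run.forLoop (N := p) (T := 150) (fun i s'' =>
      J (fun u l => u < j ∨ (u = j ∧ l < i)) s'') hW
      (by decide) (by decide) (by omega) (T' := p * 300 + 200) (by omega) ?_ ?_ ?_) (by omega) ?_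
    · intro s'' hf'
      simp [hf' 6 (by decide) (by decide), State.write, hf 6 (by decide) (by decide), hp]
    · refine hJ hI.2 (by funext x; simp [State.write]) (by funext x; simp [State.write]) ?_
      intro u _ l _ h
      omega
    · intro i hi s'' hf' hc' hI'
      have e0 : s'' 0 0 = n := by
        rw [hf' 0 (by decide) (by decide)]
        simp [State.write, hf 0 (by decide) (by decide), hn]
      have e1 : s'' 1 j = cl j := by
        rw [hf' 1 (by decide) (by decide)]
        simp [State.write, hf 1 (by decide) (by decide), hcl j hj]
      have e7 : s'' 7 (2 * i + cl j + 1) = n ^ (2 * i + cl j + 1) := by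
        have := hcl1.1 j
        rw [hf' 7 (by decide) (by decide)]
        simp [State.write, hf 7 (by decide) (by decide), h7 (2 * i + cl j + 1) (by omega)]
      have e14 : s'' 14 0 = K := by
        rw [hf' 14 (by decide) (by decide)]
        simp [State.write, hf 14 (by decide) (by decide), hK]
      have e31 : s'' 31 0 = j := by
        rw [hf' 31 (by decide) (by decide)]
        simp [State.write, hc]
      have hv : (V 31 * V 14 + (.get 7 (.lit 2 * V 26 + .get 1 (V 31) + .lit 1) + V 26)).eval s''
          = E j i := by
        simp [e31, e14, hc', e1, e7, E]
      refine Run.set_seq hW (by decide) (by decide) ?_ (by omega) ?_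
      · rw [hv]
        exact (hElt j hj i hi).trans hB
      rw [hv]
      refine Run.set_seq hW (by decide) (by decide) (by simp; omega) (by omega) ?_
      refine Run.set hW (by decide) (by decide) (by simp [State.write, hc']; omega) (by omega) ?_
      refine ⟨by simp [State.write, hc'], ?_, ?_, ?_⟩
      · intro u hu l hl h
        simp only [State.write, eval_add, eval_mul, eval_get, eval_lit, e0, e31, hc']
        simp only [Nat.reduceEqDiff, false_and, true_and, if_false, and_self, if_true]
        have h1 : (u < j ∨ u = j ∧ l < i) ∨ (u = j ∧ l = i) := by omega
        by_cases hx : E u l = E j i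
        · obtain rfl : l = i := by rw [← hEmod u l hl, hx, hEmod j i hi]
          refine ⟨by rw [if_pos hx], ?_⟩
          rcases h1 with h1 | ⟨rfl, -⟩
          · simp only [hx, mul_add_inj hu hj]
            by_cases huj : u = j
            · simp [huj]
            · rw [if_neg (by tauto), ← hx]
              exact (hI'.1 u hu l hl h1).2
          · simp
        · have h2 : u < j ∨ u = j ∧ l < i := by
            rcases h1 with h1 | ⟨rfl, rfl⟩
            · exact h1
            · exact absurd rfl hx
          simp only [mul_add_inj hu hj]
          rw [if_neg hx, if_neg (by tauto)]
          exact hI'.1 u hu l hl h2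
      · intro x hx
        by_cases h : x = E j i
        · exact ⟨j, hj, i, hi, h⟩
        · refine hI'.2.1 x ?_
          simpa [State.write, h] using hx
      · intro y hy
        by_cases h : y = E j i * n + j
        · exact ⟨j, hj, i, hi, h⟩
        · refine hI'.2.2 y ?_
          simpa [State.write, h, e0, e31] using hy
    · intro s'' hf' h
      have e11 : s'' 11 = (s'.write 11 (Expr.eval s' (V 31)) (Expr.eval s' (V 31))) 11 :=
        hf' 11 (by decide)
      refine ⟨by rw [hf' 31 (by decide)]; simpa [State.write] using hc, ?_, ?_⟩
      · intro v hv
        simp only [State.write, eval_get, eval_lit, hc, e11]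
        by_cases h : v = j
        · simp [h]
        · simpa [h] using hI.1 v (by omega)
      · refine hJ h (by funext x; simp [State.write]) (by funext x; simp [State.write]) ?_
        intro u _ l hl h
        omega
  · intro s' _ ⟨hid, h1, h2, h3⟩
    refine ⟨fun v hv => ⟨hid v hv, ?_, ?_⟩, ?_⟩
    · intro k hk hne
      obtain ⟨u, hu, l, hl, hx⟩ := h2 _ hne
      obtain ⟨rfl, rfl⟩ := (mul_add_inj hk (hkK u hu l hl)).1 hx
      obtain ⟨a1, a2⟩ := h1 v hu l hl hu
      have hrow : row n (s' 13) (v * K + (n ^ (2 * l + cl v + 1) + l)) v = l := a2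
      refine ⟨?_, ?_, ?_, ?_⟩
      · intro w hw
        rw [mem_singleton.1 hw, hrow]
        exact hl
      · intro w hw hwv
        by_contra hne'
        obtain ⟨u', hu', l', hl', hy⟩ := h3 _ hne'
        obtain ⟨b1, rfl⟩ := (mul_add_inj hw hu').1 hy
        obtain ⟨rfl, -⟩ := (mul_add_inj hk (hkK w hu' l' hl')).1 b1
        simp at hwv
      · rw [hkey, hrow]
      · rw [show s' 12 (v * K + (n ^ (2 * l + cl v + 1) + l)) = 1 from a1]
        simp [score, inner, hA]
    · intro g hg
      have hgv := hg v (by simp)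
      rw [hkey, show s' 12 (v * K + (n ^ (2 * g v + cl v + 1) + g v)) = 1
        from (h1 v hv (g v) hgv hv).1]
      simp [score, inner, hA]
    · intro x hx
      by_contra hne
      obtain ⟨u, hu, l, hl, rfl⟩ := h2 x hne
      exact absurd (hElt u hu l hl) (by omega)

end


section

variable {W B n p m K : ℕ} {s : State} {cl : ℕ → ℕ} {A : ℕ → ℕ → ℕ}

/-! ### Elimination of leaves -/

/-- `u` can be eliminated and merged into `v`: no other remaining vertex is a neighbour of `u`. -/
def IsLeafPair (A : ℕ → ℕ → ℕ) (alive : Finset ℕ) (u v : ℕ) : Prop :=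
  u ∈ alive ∧ v ∈ alive ∧ u ≠ v ∧ ∑ w ∈ alive, A u w = A u v

/-- `A u v` is itself one of the summands, so the others vanish. This also works for `A u v = 0`,
where `u` has no remaining neighbour. -/
theorem IsLeafPair.eq_zero {alive : Finset ℕ} {u v w : ℕ} (h : IsLeafPair A alive u v)
    (hw : w ∈ alive) (hwv : w ≠ v) : A u w = 0 := by
  have h1 := h.2.2.2
  rw [← add_sum_erase _ _ h.2.1] at h1
  have h2 : ∑ x ∈ alive.erase v, A u x = 0 := by omega
  exact (sum_eq_zero_iff.1 h2) w (mem_erase.2 ⟨hwv, hw⟩)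

theorem findLeaf_run {alive : Finset ℕ} (hW : 16 * B ^ 2 < W) (hn : s 0 0 = n)
    (hB : n * n < B) (hal : alive ⊆ range n) (h8 : ∀ a < n, ∀ b < n, s 8 (a * n + b) = A a b)
    (h9 : ∀ v ∈ alive, s 9 v = ∑ w ∈ alive, A v w)
    (h10 : ∀ v < n, s 10 v = if v ∈ alive then 0 else 1)
    (hex : ∃ u v, IsLeafPair A alive u v) :
    Run W B findLeaf s (n * n * 200 + 200) (fun s' =>
      ∃ u v, IsLeafPair A alive u v ∧ s' 17 0 = u * n + v) := by
  refine Run.mono (Run.forLoop (N := n * n) (T := 100) (fun j s' =>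
    -- Later finds overwrite earlier ones; any leaf pair will do.
    (∃ u v, IsLeafPair A alive u v ∧ u * n + v < j) →
      ∃ u v, IsLeafPair A alive u v ∧ s' 17 0 = u * n + v) hW (by decide) (by decide) hB
      (by omega) ?_ ?_ ?_) le_rfl ?_
  · intro s' hf
    simp [hf 0 (by decide) (by decide), hn]
  · rintro ⟨u, v, -, h⟩
    omega
  · intro j hj s' hf hc hI
    have hn0 : 0 < n := Nat.pos_of_ne_zero (by rintro rfl; simp at hj)
    have hu : j / n < n := Nat.div_lt_of_lt_mul hj
    have hv : j % n < n := Nat.mod_lt _ hn0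
    have hj' : j / n * n + j % n = j := Nat.div_add_mod' j n
    have e0 := hf 0 (by decide) (by decide)
    have e8 : s' 8 j = A (j / n) (j % n) := by
      rw [hf 8 (by decide) (by decide), ← h8 _ hu _ hv, hj']
    have e9 := hf 9 (by decide) (by decide)
    have e10 := hf 10 (by decide) (by decide)
    have hev : (less (.get 10 (V 16 / V 0) + .get 10 (V 16 % V 0) +
            .equal (V 16 / V 0) (V 16 % V 0))
          (.equal (.get 9 (V 16 / V 0)) (.get 8 (V 16)))).eval s' ≠ 0 ↔
        IsLeafPair A alive (j / n) (j % n) := by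
      simp only [eval_less, eval_add, eval_get, eval_lit, eval_div, eval_mod, eval_equal, hc, e0,
        hn, e8, e9, e10, h10 _ hu, h10 _ hv, IsLeafPair]
      by_cases h1 : j / n ∈ alive
      · rw [h9 _ h1]
        split_ifs <;> simp_all
      · split_ifs <;> simp_all
    refine Run.ite hW (by decide) (by decide) (by omega) ?_ ?_
    · intro h
      rw [hev] at h
      refine Run.set hW (by decide) (by decide) ?_ (by omega) ?_
      · simp [hc]; omega
      · refine ⟨by simp [State.write, hc], fun _ => ⟨_, _, h, ?_⟩⟩
        simp [State.write, hc, hj']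
    · intro h
      refine Run.skip ⟨hc, ?_⟩ (by omega)
      rintro ⟨u, v, huv, hlt⟩
      obtain ⟨u', v', h1, h2⟩ := hI ⟨u, v, huv, by
        by_contra hne
        have hjj : u * n + v = j / n * n + j % n := by omega
        obtain ⟨rfl, rfl⟩ := (mul_add_inj (mem_range.1 (hal huv.2.1)) hv).1 hjj
        exact hev.2 huv h⟩
      exact ⟨u', v', h1, by simpa [State.write] using h2⟩
  · rintro s' - h
    obtain ⟨u, v, huv⟩ := hex
    exact h ⟨u, v, huv, mul_add_lt (mem_range.1 (hal huv.1)) (mem_range.1 (hal huv.2.1))⟩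

/-! ### Merging of tables -/

/-- The data of a merge of the table `t₂` of `u` into the table `t₁` of `v`. -/
structure Mergeable (n p K : ℕ) (cl : ℕ → ℕ) (A : ℕ → ℕ → ℕ) (sc lab : ℕ → ℕ) (t₁ t₂ : ℕ)
    (S₁ S₂ : Finset ℕ) (v u : ℕ) : Prop where
  hKn : K = n ^ (2 * p + 1)
  hpn : p ≤ n
  hcl : BothColours n cl
  hs : ∀ a b, A a b = A b a
  hA1 : ∀ a b, A a b ≤ 1
  tab₁ : Table n p K cl A sc lab t₁ S₁ v
  tab₂ : Table n p K cl A sc lab t₂ S₂ u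
  hv : v ∈ S₁
  hu : u ∈ S₂
  hS₁ : S₁ ⊆ range n
  hS₂ : S₂ ⊆ range n
  disj : Disjoint S₁ S₂
  cross : ∀ a ∈ S₁, ∀ b ∈ S₂, A a b ≠ 0 → a = v ∧ b = u

/-- The result of combining two cells. -/
theorem Mergeable.combine {sc lab : ℕ → ℕ} {t₁ t₂ u v k₁ k₂ : ℕ} {S₁ S₂ : Finset ℕ}
    (h : Mergeable n p K cl A sc lab t₁ t₂ S₁ S₂ v u) (hk₁ : k₁ < K) (hk₂ : k₂ < K)
    (h1 : sc (t₁ * K + k₁) ≠ 0) (h2 : sc (t₂ * K + k₂) ≠ 0) {g : ℕ → ℕ}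
    (hg : ∀ w < n, g w = row n lab (t₁ * K + k₁) w + row n lab (t₂ * K + k₂) w) :
    (∀ w ∈ S₁ ∪ S₂, g w < p) ∧ (∀ w < n, w ∉ S₁ ∪ S₂ → g w = 0) ∧
    key n cl (S₁ ∪ S₂) g v = k₁ + (k₂ - k₂ % n) ∧
    score A (S₁ ∪ S₂) g = sc (t₁ * K + k₁) + sc (t₂ * K + k₂) +
      2 * (A v u * (if k₁ % n = k₂ % n then 1 else 0)) ∧ k₁ + (k₂ - k₂ % n) < K := by
  obtain ⟨a1, a2, a3, a4⟩ := h.tab₁.sound k₁ hk₁ h1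
  obtain ⟨b1, b2, b3, b4⟩ := h.tab₂.sound k₂ hk₂ h2
  have hd : ∀ w ∈ S₁, w ∉ S₂ := fun w hw hw' => disjoint_left.1 h.disj hw hw'
  -- Each row is zero outside its own set, so the sum of the two rows is the common extension of the
  -- two labellings.
  have g1 : ∀ w ∈ S₁, g w = row n lab (t₁ * K + k₁) w := fun w hw => by
    have hwn := mem_range.1 (h.hS₁ hw)
    rw [hg w hwn, b2 w hwn (hd w hw), add_zero]
  have g2 : ∀ w ∈ S₂, g w = row n lab (t₂ * K + k₂) w := fun w hw => by
    have hwn := mem_range.1 (h.hS₂ hw)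
    rw [hg w hwn, a2 w hwn (fun hw' => hd w hw' hw), zero_add]
  have hlt : ∀ w ∈ S₁ ∪ S₂, g w < p := by
    intro w hw
    rcases mem_union.1 hw with hw | hw
    · rw [g1 w hw]; exact a1 w hw
    · rw [g2 w hw]; exact b1 w hw
  have hv' := hlt v (mem_union_left _ h.hv)
  have hu' := hlt u (mem_union_right _ h.hu)
  have hpn := h.hpn
  have k1 : key n cl S₁ g v = k₁ := by rw [key_congr h.hv g1, a3]
  have k2 : key n cl S₂ g u = k₂ := by rw [key_congr h.hu g2, b3]
  have hkey : key n cl (S₁ ∪ S₂) g v = k₁ + (k₂ - k₂ % n) := by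
    rw [key_union h.disj (u := u) (by omega), k1, k2]
  refine ⟨hlt, ?_, hkey, ?_, ?_⟩
  · intro w hw hw'
    rw [mem_union, not_or] at hw'
    rw [hg w hw, a2 w hw hw'.1, b2 w hw hw'.2]
  · have m1 := key_mod (cl := cl) (S := S₁) (g := g) (r := v) (n := n) (by omega)
    have m2 := key_mod (cl := cl) (S := S₂) (g := g) (r := u) (n := n) (by omega)
    rw [k1] at m1
    rw [k2] at m2
    rw [score_union h.hs h.disj h.hv h.hu h.cross, score_congr g1, score_congr g2, a4, b4, m1, m2]
  · rw [← hkey, h.hKn]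
    exact key_lt h.hcl (union_subset h.hS₁ h.hS₂) (mem_union_left _ h.hv) hpn hlt

/-- A partially merged table: the pairs of cells in `D` have been combined. -/
structure Merging (n p K : ℕ) (cl : ℕ → ℕ) (A : ℕ → ℕ → ℕ) (sc₀ lab₀ sc lab : ℕ → ℕ)
    (t₁ t₂ t : ℕ) (S₁ S₂ : Finset ℕ) (v u : ℕ) (D : ℕ → ℕ → Prop) : Prop where
  old_sc : ∀ x < t * K, sc x = sc₀ x
  old_lab : ∀ e < t * K, ∀ w < n, lab (e * n + w) = lab₀ (e * n + w)
  fresh : ∀ x, (t + 1) * K ≤ x → sc x = 0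
  sound : ∀ k < K, sc (t * K + k) ≠ 0 →
    (∀ w ∈ S₁ ∪ S₂, row n lab (t * K + k) w < p) ∧
    (∀ w < n, w ∉ S₁ ∪ S₂ → row n lab (t * K + k) w = 0) ∧
    key n cl (S₁ ∪ S₂) (row n lab (t * K + k)) v = k ∧
    score A (S₁ ∪ S₂) (row n lab (t * K + k)) = sc (t * K + k)
  done : ∀ k₁ < K, ∀ k₂ < K, D k₁ k₂ → sc₀ (t₁ * K + k₁) ≠ 0 → sc₀ (t₂ * K + k₂) ≠ 0 →
    sc₀ (t₁ * K + k₁) + sc₀ (t₂ * K + k₂) +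
      2 * (A v u * (if k₁ % n = k₂ % n then 1 else 0)) ≤ sc (t * K + (k₁ + (k₂ - k₂ % n)))

/-- A labelling of the union restricts to both sets. The cells of the two restrictions hold scores
that are at least as large, hence nonzero, so the pair has been combined; the new cell dominates the
sum, which by `score_union` dominates the score of the labelling. -/
theorem Merging.table {sc₀ lab₀ sc lab : ℕ → ℕ} {t₁ t₂ t u v : ℕ} {S₁ S₂ : Finset ℕ}
    {D : ℕ → ℕ → Prop} (h : Mergeable n p K cl A sc₀ lab₀ t₁ t₂ S₁ S₂ v u)
    (hm : Merging n p K cl A sc₀ lab₀ sc lab t₁ t₂ t S₁ S₂ v u D)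
    (hD : ∀ k₁ < K, ∀ k₂ < K, D k₁ k₂) :
    Table n p K cl A sc lab t (S₁ ∪ S₂) v := by
  refine ⟨hm.sound, fun g hg => ?_⟩
  have hg1 : ∀ w ∈ S₁, g w < p := fun w hw => hg w (mem_union_left _ hw)
  have hg2 : ∀ w ∈ S₂, g w < p := fun w hw => hg w (mem_union_right _ hw)
  have hvp := hg1 v h.hv
  have hup := hg2 u h.hu
  have hpn := h.hpn
  have l1 : key n cl S₁ g v < K := by rw [h.hKn]; exact key_lt h.hcl h.hS₁ h.hv hpn hg1
  have l2 : key n cl S₂ g u < K := by rw [h.hKn]; exact key_lt h.hcl h.hS₂ h.hu hpn hg2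
  have c1 := h.tab₁.complete g hg1
  have c2 := h.tab₂.complete g hg2
  have p1 := score_pos (A := A) (g := g) h.hv
  have p2 := score_pos (A := A) (g := g) h.hu
  have hd := hm.done _ l1 _ l2 (hD _ l1 _ l2) (by omega) (by omega)
  rw [key_mod (r := v) (by omega), key_mod (r := u) (by omega)] at hd
  rw [key_union h.disj (u := u) (by omega), key_mod (r := u) (by omega),
    score_union h.hs h.disj h.hv h.hu h.cross]
  omega

/-- Lets the set of treated pairs change while the memory does not: a new pair is admissible if its
candidate is already dominated, and vacuous if one of its cells is empty. -/
theorem Merging.congr {sc₀ lab₀ sc lab : ℕ → ℕ} {t₁ t₂ t u v : ℕ} {S₁ S₂ : Finset ℕ}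
    {D D' : ℕ → ℕ → Prop} (hm : Merging n p K cl A sc₀ lab₀ sc lab t₁ t₂ t S₁ S₂ v u D)
    (hD : ∀ k₁ < K, ∀ k₂ < K, D' k₁ k₂ → sc₀ (t₁ * K + k₁) ≠ 0 → sc₀ (t₂ * K + k₂) ≠ 0 →
      D k₁ k₂ ∨ sc₀ (t₁ * K + k₁) + sc₀ (t₂ * K + k₂) +
        2 * (A v u * (if k₁ % n = k₂ % n then 1 else 0)) ≤ sc (t * K + (k₁ + (k₂ - k₂ % n)))) :
    Merging n p K cl A sc₀ lab₀ sc lab t₁ t₂ t S₁ S₂ v u D' where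
  old_sc := hm.old_sc
  old_lab := hm.old_lab
  fresh := hm.fresh
  sound := hm.sound
  done k₁ hk₁ k₂ hk₂ h h1 h2 := (hD k₁ hk₁ k₂ hk₂ h h1 h2).elim
    (fun h' => hm.done k₁ hk₁ k₂ hk₂ h' h1 h2) id

/-- Overwriting a cell by a better labelling. -/
theorem Merging.update {sc₀ lab₀ sc lab sc' lab' : ℕ → ℕ} {t₁ t₂ t u v k val : ℕ}
    {S₁ S₂ : Finset ℕ} {D : ℕ → ℕ → Prop}
    (h : Mergeable n p K cl A sc₀ lab₀ t₁ t₂ S₁ S₂ v u)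
    (hm : Merging n p K cl A sc₀ lab₀ sc lab t₁ t₂ t S₁ S₂ v u D) (hk : k < K)
    (hsc : sc' (t * K + k) = val) (hsc' : ∀ x, x ≠ t * K + k → sc' x = sc x)
    (hval : sc (t * K + k) < val)
    (hlab' : ∀ e, e ≠ t * K + k → ∀ w < n, lab' (e * n + w) = lab (e * n + w))
    (hsound : (∀ w ∈ S₁ ∪ S₂, row n lab' (t * K + k) w < p) ∧
      (∀ w < n, w ∉ S₁ ∪ S₂ → row n lab' (t * K + k) w = 0) ∧
      key n cl (S₁ ∪ S₂) (row n lab' (t * K + k)) v = k ∧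
      score A (S₁ ∪ S₂) (row n lab' (t * K + k)) = val) :
    Merging n p K cl A sc₀ lab₀ sc' lab' t₁ t₂ t S₁ S₂ v u D where
  old_sc x hx := by rw [hsc' x (by omega), hm.old_sc x hx]
  old_lab e he w hw := by rw [hlab' e (by omega) w hw, hm.old_lab e he w hw]
  fresh x hx := by
    rw [Nat.succ_mul] at hx
    rw [hsc' x (by omega), hm.fresh x (by rw [Nat.succ_mul]; exact hx)]
  sound k' hk' hne := by
    by_cases hkk : k' = k
    · subst hkk
      rw [hsc]
      exact hsound
    · rw [hsc' _ (by omega)] at hne ⊢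
      obtain ⟨a1, a2, a3, a4⟩ := hm.sound k' hk' hne
      have hrow : ∀ w < n, row n lab' (t * K + k') w = row n lab (t * K + k') w :=
        fun w hw => hlab' _ (by omega) w hw
      have hS : ∀ w ∈ S₁ ∪ S₂, row n lab' (t * K + k') w = row n lab (t * K + k') w :=
        fun w hw => hrow w (mem_range.1 (union_subset h.hS₁ h.hS₂ hw))
      exact ⟨fun w hw => by rw [hS w hw]; exact a1 w hw,
        fun w hw hw' => by rw [hrow w hw]; exact a2 w hw hw',
        by rw [key_congr (mem_union_left _ h.hv) hS]; exact a3, by rw [score_congr hS]; exact a4⟩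
  done k₁ hk₁ k₂ hk₂ hD h1 h2 := by
    have hd := hm.done k₁ hk₁ k₂ hk₂ hD h1 h2
    by_cases hkk : t * K + (k₁ + (k₂ - k₂ % n)) = t * K + k
    · rw [hkk] at hd ⊢
      omega
    · rw [hsc' _ hkk]
      exact hd

/-- Both source rows differ from the target row, so they stay intact while it is overwritten. -/
theorem copyRow_run {e₁ e₂ e : ℕ} (hW : 16 * B ^ 2 < W) (hn : s 0 0 = n) (hnB : n < B)
    (h20 : s 20 0 = e₁) (h21 : s 21 0 = e₂) (h22 : s 22 0 = e) (hne₁ : e₁ ≠ e) (hne₂ : e₂ ≠ e)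
    (hB : ∀ w < n, s 13 (e₁ * n + w) + s 13 (e₂ * n + w) < B) :
    Run W B (forLoop 24 (V 0) (.set 13 (V 22 * V 0 + V 24)
        (.get 13 (V 20 * V 0 + V 24) + .get 13 (V 21 * V 0 + V 24)))) s (n * 150 + 200)
      (fun s' => (∀ w < n, s' 13 (e * n + w) = s 13 (e₁ * n + w) + s 13 (e₂ * n + w)) ∧
        ∀ e', e' ≠ e → ∀ w < n, s' 13 (e' * n + w) = s 13 (e' * n + w)) := by
  refine Run.forLoop (N := n) (T := 50) (fun j s' =>
    (∀ w < j, s' 13 (e * n + w) = s 13 (e₁ * n + w) + s 13 (e₂ * n + w)) ∧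
        ∀ e', e' ≠ e → ∀ w < n, s' 13 (e' * n + w) = s 13 (e' * n + w))
    hW (by decide) (by decide) hnB (by omega) ?_ ?_ ?_
  · intro s' hf
    simp [hf 0 (by decide) (by decide), hn]
  · exact ⟨fun w hw => by omega, fun e' _ w _ => by simp [State.write]⟩
  · intro j hj s' hf hc ⟨hI1, hI2⟩
    have e0 := hf 0 (by decide) (by decide)
    have e20 := hf 20 (by decide) (by decide)
    have e21 := hf 21 (by decide) (by decide)
    have e22 := hf 22 (by decide) (by decide)
    have hv : (.get 13 (V 20 * V 0 + V 24) + .get 13 (V 21 * V 0 + V 24) : Expr).eval s' =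
        s 13 (e₁ * n + j) + s 13 (e₂ * n + j) := by
      simp [e0, e20, e21, hc, hn, h20, h21, hI2 e₁ hne₁ j hj, hI2 e₂ hne₂ j hj]
    refine Run.set hW (by decide) (by decide) ?_ (by omega) ⟨by simp [State.write, hc], ?_, ?_⟩
    · rw [hv]
      exact hB j hj
    · intro w hw
      rw [hv]
      by_cases hwj : w = j
      · simp [State.write, e0, e22, hc, hn, h22, hwj]
      · simp [State.write, e0, e22, hc, hn, h22, hwj, hI1 w (by omega)]
    · intro e' he' w hw
      rw [hv]
      simp [State.write, e0, e22, hc, hn, h22, mul_add_inj hw hj, he', hI2 e' he' w hw]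

theorem mergeCells_run {sc₀ lab₀ : ℕ → ℕ} {t₁ t₂ r u v k₁ k₂ : ℕ} {S₁ S₂ : Finset ℕ}
    {D : ℕ → ℕ → Prop} (hW : 16 * B ^ 2 < W) (hn : s 0 0 = n) (h14 : s 14 0 = K)
    (h15 : s 15 0 = r) (h18 : s 18 0 = k₁) (h19 : s 19 0 = k₂) (h31 : s 31 0 = u)
    (h32 : s 32 0 = v) (h11v : s 11 v = t₁) (h11u : s 11 u = t₂)
    (h8 : s 8 (v * n + u) = A v u) (hk₁ : k₁ < K) (hk₂ : k₂ < K) (ht₁ : t₁ < n + r)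
    (ht₂ : t₂ < n + r) (hB1 : (n + r + 1) * K < B) (hB2 : n + n * n < B)
    (h : Mergeable n p K cl A sc₀ lab₀ t₁ t₂ S₁ S₂ v u)
    (hm : Merging n p K cl A sc₀ lab₀ (s 12) (s 13) t₁ t₂ (n + r) S₁ S₂ v u D) :
    Run W B mergeCells s (n * 150 + 600) (fun s' =>
      Merging n p K cl A sc₀ lab₀ (s' 12) (s' 13) t₁ t₂ (n + r) S₁ S₂ v u
        (fun a b => D a b ∨ (a = k₁ ∧ b = k₂))) := by
  have hvn : v < n := mem_range.1 (h.hS₁ h.hv)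
  have hlt₁ : t₁ * K + k₁ < (n + r) * K := mul_add_lt ht₁ hk₁
  have hlt₂ : t₂ * K + k₂ < (n + r) * K := mul_add_lt ht₂ hk₂
  have hB1' : (n + r) * K + K < B := by rwa [Nat.succ_mul] at hB1
  have hpn := h.hpn
  refine Run.set_seq hW (by decide) (by decide) (by simp [h32, h14, h11v, h18]; omega)
    (by omega) ?_
  refine Run.set_seq hW (by decide) (by decide)
    (by simp [State.write, h31, h14, h11u, h19]; omega) (by omega) ?_
  have hs1 : s 12 (t₁ * K + k₁) = sc₀ (t₁ * K + k₁) := hm.old_sc _ hlt₁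
  have hs2 : s 12 (t₂ * K + k₂) = sc₀ (t₂ * K + k₂) := hm.old_sc _ hlt₂
  refine Run.ite hW (by decide) (by decide) (by omega) ?_ ?_
  · intro hne
    have hne' : sc₀ (t₁ * K + k₁) ≠ 0 ∧ sc₀ (t₂ * K + k₂) ≠ 0 := by
      simpa [State.write, h31, h32, h14, h11u, h11v, h18, h19, hs1, hs2] using hne
    obtain ⟨c1, c2, c3, c4, c5⟩ := h.combine hk₁ hk₂ hne'.1 hne'.2
      (g := fun w => row n lab₀ (t₁ * K + k₁) w + row n lab₀ (t₂ * K + k₂) w) fun w _ => rfl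
    have hsu := union_subset h.hS₁ h.hS₂
    -- The candidate value is the score of an actual labelling, which bounds it by `n + n * n` and
    -- makes it storable.
    have hval := score_le (g := fun w => row n lab₀ (t₁ * K + k₁) w +
      row n lab₀ (t₂ * K + k₂) w) h.hA1 hsu
    rw [c4] at hval
    refine Run.set_seq hW (by decide) (by decide) ?_ (by omega) ?_
    · simp [State.write, h15, h14, hn, h18, h19]
      omega
    refine Run.set_seq hW (by decide) (by decide) ?_ (by omega) ?_
    · simp [State.write, h31, h32, h14, h11u, h11v, h18, h19, hs1, hs2, hn, h8]
      simp at hval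
      omega
    refine Run.ite hW (by decide) (by decide) (by omega) ?_ ?_
    · intro hlt
      have hlt' : s 12 ((n + r) * K + (k₁ + (k₂ - k₂ % n))) < sc₀ (t₁ * K + k₁) +
          sc₀ (t₂ * K + k₂) + 2 * (A v u * (if k₁ % n = k₂ % n then 1 else 0)) := by
        simpa [State.write, h31, h32, h14, h11u, h11v, h18, h19, hs1, hs2, hn, h8, h15] using hlt
      refine Run.set_seq hW (by decide) (by decide) ?_ (by omega) ?_
      · simp [State.write, h31, h32, h14, h11u, h11v, h18, h19, hs1, hs2, hn, h8]
        simp at hval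
        omega
      refine Run.mono (copyRow_run hW (n := n) (e₁ := t₁ * K + k₁) (e₂ := t₂ * K + k₂)
        (e := (n + r) * K + (k₁ + (k₂ - k₂ % n))) (by simp [State.write, hn]) (by omega)
        (by simp [State.write, h32, h14, h11v, h18]) (by simp [State.write, h31, h14, h11u, h19])
        (by simp [State.write, h15, h14, hn, h18, h19]) (by omega) (by omega) ?_) (by omega) ?_
      · intro w hw
        -- The sum is a label below `p` on the union and `0` elsewhere.
        have hw' : lab₀ ((t₁ * K + k₁) * n + w) + lab₀ ((t₂ * K + k₂) * n + w) < B := by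
          by_cases hwS : w ∈ S₁ ∪ S₂
          · have := c1 w hwS
            simp only [row] at this
            omega
          · have := c2 w hw hwS
            simp only [row] at this
            omega
        simpa [State.write, hm.old_lab _ hlt₁ w hw, hm.old_lab _ hlt₂ w hw] using hw'
      · intro s' hf ⟨q1, q2⟩
        have e12 := hf 12 (by decide)
        have hnew : ∀ w < n, row n (s' 13) ((n + r) * K + (k₁ + (k₂ - k₂ % n))) w =
            row n lab₀ (t₁ * K + k₁) w + row n lab₀ (t₂ * K + k₂) w := by
          intro w hw
          rw [row, q1 w hw]
          simp [State.write, row, hm.old_lab _ hlt₁ w hw, hm.old_lab _ hlt₂ w hw]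
        obtain ⟨d1, d2, d3, d4, -⟩ := h.combine hk₁ hk₂ hne'.1 hne'.2 hnew
        have m1 := Merging.update (sc' := s' 12) (lab' := s' 13)
          (val := sc₀ (t₁ * K + k₁) +
            sc₀ (t₂ * K + k₂) + 2 * (A v u * (if k₁ % n = k₂ % n then 1 else 0)))
          h hm c5 ?_ ?_ hlt' ?_ ⟨d1, d2, d3, d4⟩
        · refine m1.congr ?_
          rintro a ha b hb (h' | ⟨rfl, rfl⟩) - -
          · exact Or.inl h'
          · right
            rw [e12]
            simp [State.write, h31, h32, h14, h11u, h11v, h18, h19, hs1, hs2, hn, h8, h15]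
        · rw [e12]
          simp [State.write, h31, h32, h14, h11u, h11v, h18, h19, hs1, hs2, hn, h8, h15]
        · intro x hx
          rw [e12]
          simp [State.write, h14, h18, h19, hn, h15, hx]
        · intro e' he' w hw
          rw [q2 e' he' w hw]
          simp [State.write]
    · intro hlt
      have hlt' : sc₀ (t₁ * K + k₁) + sc₀ (t₂ * K + k₂) +
          2 * (A v u * (if k₁ % n = k₂ % n then 1 else 0)) ≤
          s 12 ((n + r) * K + (k₁ + (k₂ - k₂ % n))) := by
        simpa [State.write, h31, h32, h14, h11u, h11v, h18, h19, hs1, hs2, hn, h8, h15] using hlt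
      refine Run.skip ?_ (by omega)
      refine Merging.congr (D := D) (by simpa [State.write_ne] using hm) ?_
      rintro a ha b hb (h' | ⟨rfl, rfl⟩) - -
      · exact Or.inl h'
      · right
        simpa [State.write] using hlt'
  · intro h0
    refine Run.skip ?_ (by omega)
    refine Merging.congr (D := D) (by simpa [State.write_ne] using hm) ?_
    rintro a ha b hb (h' | ⟨rfl, rfl⟩) h1 h2
    · exact Or.inl h'
    · exfalso
      have : sc₀ (t₁ * K + a) * sc₀ (t₂ * K + b) = 0 := by
        simpa [State.write, h31, h32, h14, h11u, h11v, h18, h19, hs1, hs2] using h0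
      rcases Nat.mul_eq_zero.1 this with h' | h'
      · exact h1 h'
      · exact h2 h'

end


section

variable {W B n p m K : ℕ} {s : State} {cl : ℕ → ℕ} {A : ℕ → ℕ → ℕ}

theorem mergeTables_run {t₁ t₂ r u v : ℕ} {S₁ S₂ : Finset ℕ}
    (hW : 16 * B ^ 2 < W) (hn : s 0 0 = n) (h14 : s 14 0 = K)
    (h15 : s 15 0 = r) (h31 : s 31 0 = u)
    (h32 : s 32 0 = v) (h11v : s 11 v = t₁) (h11u : s 11 u = t₂)
    (h8 : s 8 (v * n + u) = A v u) (ht₁ : t₁ < n + r)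
    (ht₂ : t₂ < n + r) (hB1 : (n + r + 1) * K < B) (hB2 : n + n * n < B)
    (hfresh : ∀ x, (n + r) * K ≤ x → s 12 x = 0)
    (h : Mergeable n p K cl A (s 12) (s 13) t₁ t₂ S₁ S₂ v u) :
    Run W B mergeTables s (K * (K * (n * 150 + 700) + 300) + 200) (fun s' =>
      (∀ x < (n + r) * K, s' 12 x = s 12 x) ∧
      (∀ e < (n + r) * K, ∀ w < n, s' 13 (e * n + w) = s 13 (e * n + w)) ∧
      (∀ x, (n + r + 1) * K ≤ x → s' 12 x = 0) ∧
      Table n p K cl A (s' 12) (s' 13) (n + r) (S₁ ∪ S₂) v) := by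
  have hKB : K < B := lt_of_le_of_lt (Nat.le_mul_of_pos_left _ (by omega)) hB1
  refine Run.mono (Run.forLoop (N := K) (T := K * (n * 150 + 700) + 200) (fun i s' =>
    Merging n p K cl A (s 12) (s 13) (s' 12) (s' 13) t₁ t₂ (n + r) S₁ S₂ v u
      (fun a _ => a < i)) hW (by decide) (by decide) hKB (le_of_eq (by ring)) ?_ ?_ ?_) le_rfl ?_
  · intro s' hf
    simp [hf 14 (by decide) (by decide), h14]
  · rw [State.write_ne (by decide), State.write_ne (by decide)]
    refine ⟨fun _ _ => rfl, fun _ _ _ _ => rfl, fun x hx => hfresh x ?_, ?_, ?_⟩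
    · rw [Nat.succ_mul] at hx
      omega
    · intro k _ hne
      exact absurd (hfresh _ (by omega)) hne
    · intro a _ b _ hab
      omega
  · intro i hi s' hf hc hI
    refine Run.mono (Run.forLoop (N := K) (T := n * 150 + 600) (fun j s'' =>
      Merging n p K cl A (s 12) (s 13) (s'' 12) (s'' 13) t₁ t₂ (n + r) S₁ S₂ v u
        (fun a b => a < i ∨ (a = i ∧ b < j))) hW (by decide) (by decide) hKB le_rfl
        ?_ ?_ ?_) le_rfl ?_
    · intro s'' hf'
      simp [hf' 14 (by decide) (by decide), hf 14 (by decide) (by decide), h14]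
    · rw [State.write_ne (by decide), State.write_ne (by decide)]
      refine hI.congr fun a _ b _ hab _ _ => Or.inl ?_
      omega
    · intro j hj s'' hf' hc' hI'
      have e : ∀ a, a ≠ 18 → a ≠ 19 → a ∉ mergeCells.mods → s'' a = s a := by
        intro a ha ha' ham
        rw [hf' a ha' ham, hf a ha]
        rw [Prog.mem_mods_forLoop]
        tauto
      have e11 := e 11 (by decide) (by decide) (by decide)
      refine Run.mono (mergeCells_run (k₁ := i) (k₂ := j) hW
        (by rw [e 0 (by decide) (by decide) (by decide), hn])
        (by rw [e 14 (by decide) (by decide) (by decide), h14])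
        (by rw [e 15 (by decide) (by decide) (by decide), h15])
        (by rw [hf' 18 (by decide) (by decide), hc]) hc'
        (by rw [e 31 (by decide) (by decide) (by decide), h31])
        (by rw [e 32 (by decide) (by decide) (by decide), h32])
        (by rw [e11, h11v]) (by rw [e11, h11u])
        (by rw [e 8 (by decide) (by decide) (by decide), h8]) hi hj ht₁ ht₂ hB1 hB2 h hI')
        le_rfl ?_
      intro s3 hf3 h3
      refine ⟨by rw [hf3 19 (by decide), hc'], ?_⟩
      rw [State.write_ne (by decide), State.write_ne (by decide)]
      refine h3.congr fun a _ b _ hab _ _ => Or.inl ?_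
      omega
    · intro s3 hf3 h3
      refine ⟨by rw [hf3 18 (by decide), hc], ?_⟩
      rw [State.write_ne (by decide), State.write_ne (by decide)]
      refine h3.congr fun a _ b hb hab _ _ => Or.inl ?_
      omega
  · intro s' _ hI
    exact ⟨hI.old_sc, hI.old_lab, hI.fresh, Merging.table h hI fun a ha _ _ => ha⟩

/-! ### The elimination order -/

/-- The components of the graph induced by the edges at eliminated vertices, rooted at the
remaining vertices. -/
structure Components (n : ℕ) (A : ℕ → ℕ → ℕ) (alive : Finset ℕ) (comp : ℕ → Finset ℕ) :
    Prop where
  alive_sub : alive ⊆ range n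
  mem : ∀ v ∈ alive, v ∈ comp v
  sub : ∀ v ∈ alive, comp v ⊆ range n
  disj : ∀ u ∈ alive, ∀ v ∈ alive, u ≠ v → Disjoint (comp u) (comp v)
  cover : ∀ w < n, ∃ v ∈ alive, w ∈ comp v
  cross : ∀ u ∈ alive, ∀ v ∈ alive, u ≠ v → ∀ a ∈ comp u, ∀ b ∈ comp v, A a b ≠ 0 →
    a = u ∧ b = v

/-- By `cross`, an edge leaving `comp u` starts at `u` and ends at a remaining vertex, which can
only be `v`. So every edge leaving the merged set starts at its root `v`. -/
theorem Components.eliminate {alive : Finset ℕ} {comp : ℕ → Finset ℕ} {u v : ℕ}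
    (hs : ∀ a b, A a b = A b a) (h : Components n A alive comp) (huv : IsLeafPair A alive u v) :
    Components n A (alive.erase u) (Function.update comp v (comp v ∪ comp u)) := by
  have hu := huv.1
  have hv := huv.2.1
  have hne := huv.2.2.1
  have hz : ∀ w ∈ alive, w ≠ v → w ≠ u → ∀ a ∈ comp u, ∀ b ∈ comp w, A a b = 0 := by
    intro w hw hwv hwu a ha b hb
    by_contra hab
    obtain ⟨rfl, rfl⟩ := h.cross u hu w hw (Ne.symm hwu) a ha b hb hab
    exact hab (huv.eq_zero hw hwv)
  have hup : ∀ w, w ≠ v → Function.update comp v (comp v ∪ comp u) w = comp w :=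
    fun w hw => Function.update_of_ne hw _ _
  have hupv : Function.update comp v (comp v ∪ comp u) v = comp v ∪ comp u :=
    Function.update_self _ _ _
  constructor
  · exact (erase_subset _ _).trans h.alive_sub
  · intro w hw
    have hw' := mem_of_mem_erase hw
    by_cases hwv : w = v
    · subst hwv
      rw [hupv]
      exact mem_union_left _ (h.mem w hw')
    · rw [hup w hwv]
      exact h.mem w hw'
  · intro w hw
    have hw' := mem_of_mem_erase hw
    by_cases hwv : w = v
    · subst hwv
      rw [hupv]
      exact union_subset (h.sub w hw') (h.sub u hu)
    · rw [hup w hwv]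
      exact h.sub w hw'
  · intro a ha b hb hab
    obtain ⟨hau, ha⟩ := mem_erase.1 ha
    obtain ⟨hbu, hb⟩ := mem_erase.1 hb
    by_cases hav : a = v
    · subst hav
      rw [hupv, hup b (Ne.symm hab), disjoint_union_left]
      exact ⟨h.disj a ha b hb hab, h.disj u hu b hb (Ne.symm hbu)⟩
    · rw [hup a hav]
      by_cases hbv : b = v
      · subst hbv
        rw [hupv, disjoint_union_right]
        exact ⟨h.disj a ha b hb hab, h.disj a ha u hu hau⟩
      · rw [hup b hbv]
        exact h.disj a ha b hb hab
  · intro w hw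
    obtain ⟨x, hx, hwx⟩ := h.cover w hw
    by_cases hxv : x = u ∨ x = v
    · refine ⟨v, mem_erase.2 ⟨Ne.symm hne, hv⟩, ?_⟩
      rw [hupv, mem_union]
      rcases hxv with rfl | rfl
      · exact Or.inr hwx
      · exact Or.inl hwx
    · rw [not_or] at hxv
      exact ⟨x, mem_erase.2 ⟨hxv.1, hx⟩, by rwa [hup x hxv.2]⟩
  · intro a ha b hb hab x hx y hy hxy
    obtain ⟨hau, ha⟩ := mem_erase.1 ha
    obtain ⟨hbu, hb⟩ := mem_erase.1 hb
    by_cases hav : a = v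
    · subst hav
      rw [hupv, mem_union] at hx
      rw [hup b (Ne.symm hab)] at hy
      rcases hx with hx | hx
      · exact h.cross a ha b hb hab x hx y hy hxy
      · exact absurd (hz b hb (Ne.symm hab) hbu x hx y hy) hxy
    · rw [hup a hav] at hx
      by_cases hbv : b = v
      · subst hbv
        rw [hupv, mem_union] at hy
        rcases hy with hy | hy
        · exact h.cross a ha b hb hab x hx y hy hxy
        · rw [hs] at hxy
          exact absurd (hz a ha hab hau y hy x hx) hxy
      · rw [hup b hbv] at hy
        exact h.cross a ha b hb hab x hx y hy hxy

/-- The invariant of the elimination after `r` rounds. -/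
def Eliminated (n p K : ℕ) (cl : ℕ → ℕ) (A : ℕ → ℕ → ℕ) (r : ℕ) (s : State) : Prop :=
  ∃ (alive : Finset ℕ) (comp : ℕ → Finset ℕ), alive.card + r = n ∧ Components n A alive comp ∧
    (∀ v ∈ alive, s 9 v = ∑ w ∈ alive, A v w) ∧
    (∀ v < n, s 10 v = if v ∈ alive then 0 else 1) ∧
    (∀ v ∈ alive, s 11 v < n + r ∧ Table n p K cl A (s 12) (s 13) (s 11 v) (comp v) v) ∧
    (r ≠ 0 → ∃ v ∈ alive, s 11 v = n + r - 1) ∧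
    ∀ x, (n + r) * K ≤ x → s 12 x = 0

theorem eliminate_run {r : ℕ} (hW : 16 * B ^ 2 < W) (hn : s 0 0 = n) (h14 : s 14 0 = K)
    (h15 : s 15 0 = r) (hKn : K = n ^ (2 * p + 1)) (hpn : p ≤ n) (hcl : BothColours n cl)
    (hs : ∀ a b, A a b = A b a) (hA1 : ∀ a b, A a b ≤ 1)
    (h8 : ∀ a < n, ∀ b < n, s 8 (a * n + b) = A a b)
    (hr : r + 1 < n) (hB1 : (n + r + 1) * K < B) (hB2 : n + n * n < B) (hnK : n ≤ K)
    (hleaf : ∀ alive ⊆ range n, 2 ≤ alive.card → ∃ u v, IsLeafPair A alive u v)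
    (h : Eliminated n p K cl A r s) :
    Run W B eliminate s (n * n * 200 + K * (K * (n * 150 + 700) + 300) + 1000)
      (Eliminated n p K cl A (r + 1)) := by
  obtain ⟨alive, comp, hcard, hC, h9, h10, htab, -, hfresh⟩ := h
  have hn1 : n + r + 1 ≤ (n + r + 1) * K := Nat.le_mul_of_pos_right _ (by omega)
  refine Run.mono (T := (n * n * 200 + 200) + (50 + (50 +
    ((K * (K * (n * 150 + 700) + 300) + 200) + 150)))) ?_ (by omega) fun _ _ h => h
  refine Run.seq (findLeaf_run hW hn (by omega) hC.alive_sub h8 h9 h10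
    (hleaf alive hC.alive_sub (by omega))) ?_
  rintro s1 hf1 ⟨u, v, huv, h17⟩
  have hu := huv.1
  have hv := huv.2.1
  have hne := huv.2.2.1
  have hun := mem_range.1 (hC.alive_sub hu)
  have hvn := mem_range.1 (hC.alive_sub hv)
  have hdiv : (u * n + v) / n = u := by
    rw [mul_comm, Nat.mul_add_div (by omega), Nat.div_eq_of_lt hvn, add_zero]
  have hmod : (u * n + v) % n = v := by
    rw [mul_comm, Nat.mul_add_mod, Nat.mod_eq_of_lt hvn]
  have e : ∀ a, a ∉ findLeaf.mods → s1 a = s a := hf1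
  have e0 : s1 0 0 = n := by rw [e 0 (by decide), hn]
  refine Run.set_seq hW (by decide) (by decide) (by simp [h17, e0, hdiv]; omega) (by omega) ?_
  refine Run.set_seq hW (by decide) (by decide)
    (by simp [State.write, h17, e0, hmod]; omega) (by omega) ?_
  rw [show (V 17 / V 0 : Expr).eval s1 = u by simp [h17, e0, hdiv],
    show (V 17 % V 0 : Expr).eval (s1.write 31 ((Expr.lit 0).eval s1) u) = v by
      simp [State.write, h17, e0, hmod]]
  set s2 := (s1.write 31 ((Expr.lit 0).eval s1) u).write 32
    ((Expr.lit 0).eval (s1.write 31 ((Expr.lit 0).eval s1) u)) v with hs2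
  have e2 : ∀ a, a ≠ 31 → a ≠ 32 → a ∉ findLeaf.mods → s2 a = s a := by
    intro a ha ha' ham
    rw [hs2, State.write_ne ha', State.write_ne ha, e a ham]
  have f0 : s2 0 0 = n := by rw [e2 0 (by decide) (by decide) (by decide), hn]
  have f8 := e2 8 (by decide) (by decide) (by decide)
  have f9 := e2 9 (by decide) (by decide) (by decide)
  have f10 := e2 10 (by decide) (by decide) (by decide)
  have f11 := e2 11 (by decide) (by decide) (by decide)
  have f12 := e2 12 (by decide) (by decide) (by decide)
  have f13 := e2 13 (by decide) (by decide) (by decide)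
  have f15 : s2 15 0 = r := by rw [e2 15 (by decide) (by decide) (by decide), h15]
  have f31 : s2 31 0 = u := by simp [hs2, State.write]
  have f32 : s2 32 0 = v := by simp [hs2, State.write]
  have f8' : s2 8 (v * n + u) = A v u := by rw [f8, h8 v hvn u hun]
  refine Run.mono (T := (K * (K * (n * 150 + 700) + 300) + 200) + 150) ?_ (by omega)
    fun _ _ h => h
  refine Run.seq (mergeTables_run (p := p) (cl := cl) (A := A) (t₁ := s 11 v) (t₂ := s 11 u)
    (S₁ := comp v) (S₂ := comp u) (v := v) (u := u) (r := r) hW f0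
    (by rw [e2 14 (by decide) (by decide) (by decide), h14]) f15 f31 f32
    (by rw [f11]) (by rw [f11]) f8' (htab v hv).1 (htab u hu).1 hB1 hB2
    (by rw [f12]; exact hfresh) ?_) ?_
  · rw [f12, f13]
    exact ⟨hKn, hpn, hcl, hs, hA1, (htab v hv).2, (htab u hu).2, hC.mem v hv, hC.mem u hu,
      hC.sub v hv, hC.sub u hu, hC.disj v hv u hu (Ne.symm hne),
      hC.cross v hv u hu (Ne.symm hne)⟩
  intro s3 hf3 ⟨o12, o13, o3, hT⟩
  rw [f12] at o12
  rw [f13] at o13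
  have i0 : s3 0 0 = n := by rw [hf3 0 (by decide), f0]
  have i8 : s3 8 (v * n + u) = A v u := by rw [hf3 8 (by decide), f8']
  have i9 : s3 9 = s 9 := by rw [hf3 9 (by decide), f9]
  have i10 : s3 10 = s 10 := by rw [hf3 10 (by decide), f10]
  have i11 : s3 11 = s 11 := by rw [hf3 11 (by decide), f11]
  have i15 : s3 15 0 = r := by rw [hf3 15 (by decide), f15]
  have i31 : s3 31 0 = u := by rw [hf3 31 (by decide), f31]
  have i32 : s3 32 0 = v := by rw [hf3 32 (by decide), f32]
  have hdeg : ∀ w ∈ alive, ∑ x ∈ alive, A w x ≤ n := by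
    intro w _
    have h1 : ∑ x ∈ alive, A w x ≤ alive.card * 1 :=
      sum_le_card_nsmul _ _ 1 fun x _ => hA1 w x
    omega
  refine Run.set_seq hW (by decide) (by decide) (by simp [i0, i15]; omega) (by omega) ?_
  refine Run.set_seq hW (by decide) (by decide) (by simp; omega) (by omega) ?_
  refine Run.set hW (by decide) (by decide) ?_ (by omega) ?_
  · have := hdeg v hv
    rw [← h9 v hv] at this
    simp [State.write, i32, i9, i31, i0, i8]
    omega
  set s4 := ((s3.write 11 _ _).write 10 _ _).write 9 _ _ with hs4
  have j9 : ∀ w, s4 9 w = if w = v then s 9 v - A v u else s 9 w := by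
    intro w
    simp [hs4, State.write, i32, i9, i31, i0, i8]
  have j10 : ∀ w, s4 10 w = if w = u then 1 else s 10 w := by
    intro w
    simp [hs4, State.write, i10, i31]
  have j11 : ∀ w, s4 11 w = if w = v then n + r else s 11 w := by
    intro w
    simp [hs4, State.write, i11, i32, i0, i15]
  have j12 : s4 12 = s3 12 := by
    rw [hs4, State.write_ne (by decide), State.write_ne (by decide), State.write_ne (by decide)]
  have j13 : s4 13 = s3 13 := by
    rw [hs4, State.write_ne (by decide), State.write_ne (by decide), State.write_ne (by decide)]
  have hvm : v ∈ alive.erase u := mem_erase.2 ⟨Ne.symm hne, hv⟩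
  refine ⟨alive.erase u, Function.update comp v (comp v ∪ comp u), ?_, hC.eliminate hs huv,
    ?_, ?_, ?_, ?_, ?_⟩
  · have := card_erase_of_mem hu
    omega
  -- Eliminating `u` can change the remaining degree of `v` only, because `u` has no other remaining
  -- neighbour.
  · intro w hw
    obtain ⟨hwu, hw⟩ := mem_erase.1 hw
    have h1 := h9 w hw
    rw [← add_sum_erase _ _ hu] at h1
    rw [j9]
    by_cases hwv : w = v
    · subst hwv
      rw [if_pos rfl, h1]
      omega
    · rw [if_neg hwv, h1, hs w u, huv.eq_zero hw hwv, zero_add]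
  · intro w hw
    rw [j10, h10 w hw]
    by_cases hwu : w = u
    · simp [hwu]
    · simp [hwu]
  · intro w hw
    obtain ⟨hwu, hw⟩ := mem_erase.1 hw
    rw [j11, j12, j13]
    by_cases hwv : w = v
    · subst hwv
      rw [if_pos rfl, Function.update_self]
      exact ⟨by omega, hT⟩
    · rw [if_neg hwv, Function.update_of_ne hwv]
      obtain ⟨ht, hTw⟩ := htab w hw
      -- The tables of the other roots lie in earlier blocks, which the merge has left unchanged.
      have hle : (s 11 w + 1) * K ≤ (n + r) * K := Nat.mul_le_mul_right _ ht
      refine ⟨by omega, hTw.congr (hC.sub w hw) ?_ (hC.mem w hw) ?_ ?_⟩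
      · intro g hg
        rw [hKn]
        exact key_lt hcl (hC.sub w hw) (hC.mem w hw) hpn hg
      · intro x hx
        exact o12 x (by omega)
      · intro x hx
        have h1 : x / n < (n + r) * K := by
          refine lt_of_lt_of_le (Nat.div_lt_of_lt_mul ?_) hle
          rwa [mul_comm]
        have h2 := o13 _ h1 (x % n) (Nat.mod_lt _ (by omega))
        rwa [Nat.div_add_mod'] at h2
  · intro _
    exact ⟨v, hvm, by rw [j11, if_pos rfl]; omega⟩
  · intro x hx
    rw [j12]
    exact o3 x hx

theorem eliminate_all_run (hW : 16 * B ^ 2 < W) (hn : s 0 0 = n) (h14 : s 14 0 = K)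
    (hKn : K = n ^ (2 * p + 1)) (hpn : p ≤ n) (hcl : BothColours n cl)
    (hs : ∀ a b, A a b = A b a) (hA1 : ∀ a b, A a b ≤ 1)
    (h8 : ∀ a < n, ∀ b < n, s 8 (a * n + b) = A a b) (h10 : ∀ x, s 10 x = 0)
    (h9 : ∀ a < n, s 9 a = ∑ b ∈ range n, A a b)
    (hn2 : 2 ≤ n) (hB1 : 2 * n * K < B) (hB2 : n + n * n < B) (hnK : n ≤ K)
    (hleaf : ∀ alive ⊆ range n, 2 ≤ alive.card → ∃ u v, IsLeafPair A alive u v)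
    (htab : ∀ v < n, s 11 v = v ∧ Table n p K cl A (s 12) (s 13) v {v} v)
    (hfresh : ∀ x, n * K ≤ x → s 12 x = 0) :
    Run W B (forLoop 15 (V 0 - .lit 1) eliminate) s
      (n * (n * n * 200 + K * (K * (n * 150 + 700) + 300) + 1100) + 200) (fun s' =>
        ∃ v < n, Table n p K cl A (s' 12) (s' 13) (2 * n - 2) (range n) v) := by
  have hn1 : n - 1 ≠ 0 := by omega
  refine Run.mono (Run.forLoop (N := n - 1)
    (T := n * n * 200 + K * (K * (n * 150 + 700) + 300) + 1000)
    (fun r s' => Eliminated n p K cl A r s') hW (by decide) (by decide) (by omega) le_rfl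
    ?_ ?_ ?_) ?_ ?_
  · intro s' hf
    simp [hf 0 (by decide) (by decide), hn]
  · refine ⟨range n, fun v => {v}, by simp, ?_, ?_, ?_, ?_, by simp, ?_⟩
    · refine ⟨subset_rfl, by simp, by simp, ?_, by simp, ?_⟩
      · intro u _ v _ huv
        simpa using huv
      · intro u _ v _ _ a ha b hb _
        exact ⟨mem_singleton.1 ha, mem_singleton.1 hb⟩
    · intro v hv
      simpa [State.write] using h9 v (mem_range.1 hv)
    · intro v hv
      simp [State.write, h10, hv]
    · intro v hv
      rw [mem_range] at hv
      rw [State.write_ne (by decide), State.write_ne (by decide), State.write_ne (by decide),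
        (htab v hv).1]
      exact ⟨by omega, (htab v hv).2⟩
    · intro x hx
      rw [State.write_ne (by decide)]
      exact hfresh x hx
  · intro r hr s' hf hc hI
    have e8 := hf 8 (by decide) (by decide)
    refine Run.mono (eliminate_run (r := r) hW (by rw [hf 0 (by decide) (by decide), hn])
      (by rw [hf 14 (by decide) (by decide), h14]) hc hKn hpn hcl hs hA1
      (by rw [e8]; exact h8) (by omega) ?_ hB2 hnK hleaf hI) le_rfl ?_
    · exact lt_of_le_of_lt (Nat.mul_le_mul_right K (by omega)) hB1
    · intro s'' hf' h'
      refine ⟨by rw [hf' 15 (by decide), hc], ?_⟩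
      simpa only [Eliminated, State.write_ne (show (9 : ℕ) ≠ 15 by decide),
        State.write_ne (show (10 : ℕ) ≠ 15 by decide),
        State.write_ne (show (11 : ℕ) ≠ 15 by decide),
        State.write_ne (show (12 : ℕ) ≠ 15 by decide),
        State.write_ne (show (13 : ℕ) ≠ 15 by decide)] using h'
  · exact Nat.add_le_add_right (Nat.mul_le_mul (Nat.sub_le n 1) le_rfl) 200
  · rintro s' - ⟨alive, comp, hcard, hC, -, -, ht, hlast, -⟩
    -- After `n - 1` rounds one root is left. By `cover` its set is everything, and its table is the
    -- one created last, with number `2 * n - 2`.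
    obtain ⟨v, hv, hid⟩ := hlast hn1
    clear hlast
    have hal : alive = {v} := by
      obtain ⟨x, hx⟩ := card_eq_one.1 (show alive.card = 1 by omega)
      rw [hx, mem_singleton] at hv
      rw [hx, hv]
    have hcomp : comp v = range n := by
      refine subset_antisymm (hC.sub v hv) fun w hw => ?_
      obtain ⟨x, hx, hwx⟩ := hC.cover w (mem_range.1 hw)
      rw [hal, mem_singleton] at hx
      rwa [← hx]
    have h2 := (ht v hv).2
    rw [hid, hcomp, show n + (n - 1) - 1 = 2 * n - 2 by omega] at h2
    exact ⟨v, mem_range.1 (hC.alive_sub hv), h2⟩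

end


section

variable {W B n p m K : ℕ} {s : State} {cl : ℕ → ℕ} {A : ℕ → ℕ → ℕ}

/-! ### The best fair labelling -/

/-- All clusters are fair, where `N` vertices have colour `1`. -/
def FairCounts (n p N : ℕ) (d : ℕ → ℕ) : Prop :=
  ∀ l < p, d (2 * l) * N = d (2 * l + 1) * (n - N)

/-- The sum of the squares of the cluster sizes. -/
def sumSquares (p : ℕ) (d : ℕ → ℕ) : ℕ :=
  ∑ l ∈ range p, (d (2 * l) + d (2 * l + 1)) * (d (2 * l) + d (2 * l + 1))

/-- The numbers of vertices of each label and colour, read off a key. -/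
def digits (n k : ℕ) (i : ℕ) : ℕ := k / n ^ (i + 1) % n

/-- The program rates every index below `K`, and its digits need not be the counts of any labelling;
hence this bound, cruder than `n * n`. -/
theorem sumSquares_le {d : ℕ → ℕ} (hd : ∀ i, d i < n) (hpn : p ≤ n) :
    sumSquares p d ≤ 4 * n * n * n := by
  have h : sumSquares p d ≤ (range p).card • (2 * n * (2 * n)) :=
    sum_le_card_nsmul _ _ _ fun l _ => by
      have h1 := hd (2 * l)
      have h2 := hd (2 * l + 1)
      exact Nat.mul_le_mul (by omega) (by omega)
  rw [card_range, smul_eq_mul] at h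
  calc _ ≤ _ := h
    _ ≤ n * (2 * n * (2 * n)) := Nat.mul_le_mul_right _ hpn
    _ = _ := by ring

theorem rateCell_run {N k : ℕ} (hW : 16 * B ^ 2 < W) (hn : s 0 0 = n) (hN : s 5 0 = N)
    (hp : s 6 0 = p) (h14 : s 14 0 = K) (h25 : s 25 0 = k) (hk : k < K) (hpn : p ≤ n)
    (hn2 : 2 ≤ n) (h7 : ∀ i ≤ 2 * p + 1, s 7 i = n ^ i)
    (hB1 : 2 * n * K < B) (hB2 : 4 * n * n * n < B)
    (h12 : s 12 ((2 * n - 2) * K + k) ≤ n + n * n) :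
    Run W B rateCell s (p * 300 + 700) (fun s' =>
      ((FairCounts n p N (digits n k) ∧ 0 < s 12 ((2 * n - 2) * K + k) ∧
          s 29 0 < n * n + 2 * s 12 ((2 * n - 2) * K + k) - sumSquares p (digits n k)) →
        s' 29 0 = n * n + 2 * s 12 ((2 * n - 2) * K + k) - sumSquares p (digits n k) ∧
        s' 30 0 = (2 * n - 2) * K + k) ∧
      (¬ (FairCounts n p N (digits n k) ∧ 0 < s 12 ((2 * n - 2) * K + k) ∧
          s 29 0 < n * n + 2 * s 12 ((2 * n - 2) * K + k) - sumSquares p (digits n k)) →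
        s' 29 0 = s 29 0 ∧ s' 30 0 = s 30 0)) := by
  have hdig : ∀ i, digits n k i < n := fun i => Nat.mod_lt _ (by omega)
  have hnB : n + 1 < B := by nlinarith
  have heB : (2 * n - 2) * K + k < 2 * n * K := mul_add_lt (by omega) hk
  refine Run.set_seq hW (by decide) (by decide) (by simp [hn, h14, h25]; omega) (by omega) ?_
  refine Run.set_seq hW (by decide) (by decide) (by simp; omega) (by omega) ?_
  refine Run.set_seq hW (by decide) (by decide) (by simp; omega) (by omega) ?_
  refine Run.mono (T := (p * 300 + 200) + 300) ?_ (by omega) fun _ _ h => h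
  refine Run.seq (Run.forLoop (N := p) (T := 200) (fun j s' =>
    s' 27 0 = ∑ l ∈ range j, (1 - if digits n k (2 * l) * N = digits n k (2 * l + 1) * (n - N)
      then 1 else 0) ∧ s' 28 0 = sumSquares j (digits n k)) hW (by decide) (by decide) (by omega)
      (by omega) ?_ ?_ ?_) ?_
  · intro s' hf
    simp [hf 6 (by decide) (by decide), State.write, hp]
  · simp [State.write, sumSquares]
  · intro j hj s' hf hc ⟨hI1, hI2⟩
    have e0 : s' 0 0 = n := by rw [hf 0 (by decide) (by decide)]; simpa [State.write] using hn
    have e5 : s' 5 0 = N := by rw [hf 5 (by decide) (by decide)]; simpa [State.write] using hN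
    have e25 : s' 25 0 = k := by
      rw [hf 25 (by decide) (by decide)]; simpa [State.write] using h25
    have e7 : ∀ i ≤ 2 * p + 1, s' 7 i = n ^ i := by
      intro i hi
      rw [hf 7 (by decide) (by decide)]; simpa [State.write] using h7 i hi
    have b1 : s' 25 0 / s' 7 (2 * j + 1) % n = digits n k (2 * j) := by
      rw [e25, e7 _ (by omega)]
      rfl
    have b2 : s' 25 0 / s' 7 (2 * j + 2) % n = digits n k (2 * j + 1) := by
      rw [e25, e7 _ (by omega)]
      rfl
    have d1 := hdig (2 * j)
    have d2 := hdig (2 * j + 1)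
    have hs1 : ∑ l ∈ range (j + 1), (1 - if digits n k (2 * l) * N =
        digits n k (2 * l + 1) * (n - N) then 1 else 0) ≤ (j + 1) * 1 := by
      exact (sum_le_card_nsmul _ _ 1 fun l _ => by omega).trans (by simp)
    have hs2 := sumSquares_le hdig (show j + 1 ≤ n by omega)
    have hq1 := sum_range_succ (fun l => 1 - if digits n k (2 * l) * N =
        digits n k (2 * l + 1) * (n - N) then 1 else 0) j
    have hq2 : sumSquares (j + 1) (digits n k) = sumSquares j (digits n k) +
      (digits n k (2 * j) + digits n k (2 * j + 1)) *
        (digits n k (2 * j) + digits n k (2 * j + 1)) := sum_range_succ _ _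
    rw [hq1] at hs1
    rw [hq2] at hs2
    refine Run.set_seq hW (by decide) (by decide) (by simp [hc, e0, b1]; omega) (by omega) ?_
    refine Run.set_seq hW (by decide) (by decide) (by simp [State.write, hc, e0, b2]; omega)
      (by omega) ?_
    refine Run.set_seq hW (by decide) (by decide)
      (by simp [State.write, hc, e0, b1, b2, e5, hI1]; omega) (by omega) ?_
    refine Run.set hW (by decide) (by decide)
      (by simp [State.write, hc, e0, b1, b2, hI2]; omega) (by omega) ⟨?_, ?_, ?_⟩
    · simp [State.write, hc]
    · rw [hq1]
      simp [State.write, hc, e0, b1, b2, e5, hI1]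
    · rw [hq2]
      simp [State.write, hc, e0, b1, b2, hI2]
  · intro s1 hf ⟨hI1, hI2⟩
    have hfair : s1 27 0 = 0 ↔ FairCounts n p N (digits n k) := by
      rw [hI1, sum_eq_zero_iff]
      simp only [mem_range, FairCounts]
      refine forall₂_congr fun l _ => ?_
      split_ifs with h <;> simp [h]
    have e0 : s1 0 0 = n := by rw [hf 0 (by decide)]; simpa [State.write] using hn
    have e12 : s1 12 = s 12 := by
      rw [hf 12 (by decide), State.write_ne (by decide), State.write_ne (by decide),
        State.write_ne (by decide)]
    have e22 : s1 22 0 = (2 * n - 2) * K + k := by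
      rw [hf 22 (by decide)]
      simp [State.write, hn, h14, h25]
    have e29 : s1 29 0 = s 29 0 := by rw [hf 29 (by decide)]; simp [State.write]
    have e30 : s1 30 0 = s 30 0 := by rw [hf 30 (by decide)]; simp [State.write]
    have hval : (V 0 * V 0 + .lit 2 * .get 12 (V 22) - V 28 : Expr).eval s1 =
        n * n + 2 * s 12 ((2 * n - 2) * K + k) - sumSquares p (digits n k) := by
      simp [e0, e12, e22, hI2]
    have hvB : n * n + 2 * s 12 ((2 * n - 2) * K + k) - sumSquares p (digits n k) < B := by
      have : n * n + 2 * (n + n * n) ≤ 4 * n * n * n := by nlinarith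
      omega
    refine Run.set_seq hW (by decide) (by decide) (by rw [hval]; exact hvB) (by omega) ?_
    rw [hval]
    have hcond : (.equal (V 27) (.lit 0) * .less (.lit 0) (.get 12 (V 22)) *
        .less (V 29) (V 23) : Expr).eval (s1.write 23 ((Expr.lit 0).eval s1)
          (n * n + 2 * s 12 ((2 * n - 2) * K + k) - sumSquares p (digits n k))) ≠ 0 ↔
        (FairCounts n p N (digits n k) ∧ 0 < s 12 ((2 * n - 2) * K + k) ∧
          s 29 0 < n * n + 2 * s 12 ((2 * n - 2) * K + k) - sumSquares p (digits n k)) := by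
      simp only [eval_mul, eval_equal, eval_less, eval_get, eval_lit, State.write]
      simp only [Nat.reduceEqDiff, false_and, if_false, and_self, if_true, e12, e22, e29, ← hfair,
        ne_eq, mul_eq_zero, not_or, ite_eq_right_iff, one_ne_zero, imp_false, not_not, and_assoc]
    refine Run.ite hW (by decide) (by decide) (by omega) ?_ ?_
    · intro h
      rw [hcond] at h
      refine Run.set_seq hW (by decide) (by decide) (by simpa [State.write] using hvB)
        (by omega) ?_
      refine Run.set hW (by decide) (by decide) ?_ (by omega) ⟨fun _ => ?_, fun h' => absurd h h'⟩
      · simp [State.write, e22]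
        omega
      · simp [State.write, e22]
    · intro h
      refine Run.skip ⟨fun h' => absurd h (hcond.2 h'), fun _ => ?_⟩ (by omega)
      simp [State.write, e29, e30]

/-- The best value starts at `0`, so the recorded cell is meaningful only once this value is
nonzero. -/
theorem findBest_run {N : ℕ} (hW : 16 * B ^ 2 < W) (hn : s 0 0 = n) (hN : s 5 0 = N)
    (hp : s 6 0 = p) (h14 : s 14 0 = K) (hpn : p ≤ n)
    (hn2 : 2 ≤ n) (h7 : ∀ i ≤ 2 * p + 1, s 7 i = n ^ i)
    (hB1 : 2 * n * K < B) (hB2 : 4 * n * n * n < B) (h29 : s 29 0 = 0)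
    (h12 : ∀ k < K, s 12 ((2 * n - 2) * K + k) ≤ n + n * n) :
    Run W B findBest s (K * (p * 300 + 800) + 200) (fun s' =>
      (∀ k < K, FairCounts n p N (digits n k) → 0 < s 12 ((2 * n - 2) * K + k) →
        n * n + 2 * s 12 ((2 * n - 2) * K + k) - sumSquares p (digits n k) ≤ s' 29 0) ∧
      (s' 29 0 ≠ 0 → ∃ k < K, FairCounts n p N (digits n k) ∧
        0 < s 12 ((2 * n - 2) * K + k) ∧
        s' 29 0 = n * n + 2 * s 12 ((2 * n - 2) * K + k) - sumSquares p (digits n k) ∧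
        s' 30 0 = (2 * n - 2) * K + k)) := by
  have hKB : K < B := lt_of_le_of_lt (Nat.le_mul_of_pos_left _ (by omega)) hB1
  refine Run.forLoop (N := K) (T := p * 300 + 700) (fun j s' =>
    (∀ k < j, FairCounts n p N (digits n k) → 0 < s 12 ((2 * n - 2) * K + k) →
        n * n + 2 * s 12 ((2 * n - 2) * K + k) - sumSquares p (digits n k) ≤ s' 29 0) ∧
      (s' 29 0 ≠ 0 → ∃ k < K, FairCounts n p N (digits n k) ∧
        0 < s 12 ((2 * n - 2) * K + k) ∧
        s' 29 0 = n * n + 2 * s 12 ((2 * n - 2) * K + k) - sumSquares p (digits n k) ∧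
        s' 30 0 = (2 * n - 2) * K + k)) hW (by decide) (by decide) hKB le_rfl ?_ ?_ ?_
  · intro s' hf
    simp [hf 14 (by decide) (by decide), h14]
  · refine ⟨fun k hk => by omega, fun h => absurd ?_ h⟩
    rw [State.write_ne (by decide), h29]
  · intro j hj s' hf hc ⟨hI1, hI2⟩
    have e12 := hf 12 (by decide) (by decide)
    refine Run.mono (rateCell_run (p := p) (N := N) (k := j) (K := K) hW
      (by rw [hf 0 (by decide) (by decide), hn]) (by rw [hf 5 (by decide) (by decide), hN])
      (by rw [hf 6 (by decide) (by decide), hp]) (by rw [hf 14 (by decide) (by decide), h14]) hc hj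
      hpn hn2 (by rw [hf 7 (by decide) (by decide)]; exact h7) hB1 hB2
      (by rw [e12]; exact h12 j hj)) le_rfl ?_
    intro s'' hf' ⟨q1, q2⟩
    rw [e12] at q1 q2
    refine ⟨by rw [hf' 25 (by decide), hc], ?_⟩
    rw [State.write_ne (by decide), State.write_ne (by decide)]
    by_cases h : FairCounts n p N (digits n j) ∧ 0 < s 12 ((2 * n - 2) * K + j) ∧
      s' 29 0 < n * n + 2 * s 12 ((2 * n - 2) * K + j) - sumSquares p (digits n j)
    · obtain ⟨r1, r2⟩ := q1 h
      refine ⟨?_, fun _ => ⟨j, hj, h.1, h.2.1, r1, r2⟩⟩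
      intro k hk hfk hsk
      rw [r1]
      rcases Nat.lt_or_ge k j with hkj | hkj
      · exact (hI1 k hkj hfk hsk).trans h.2.2.le
      · rw [show k = j by omega]
    · obtain ⟨r1, r2⟩ := q2 h
      rw [r1, r2]
      refine ⟨?_, hI2⟩
      intro k hk hfk hsk
      rcases Nat.lt_or_ge k j with hkj | hkj
      · exact hI1 k hkj hfk hsk
      · obtain rfl : k = j := by omega
        by_contra hlt
        exact h ⟨hfk, hsk, by omega⟩

theorem output_run {e : ℕ} (hW : 16 * B ^ 2 < W) (hn : s 0 0 = n) (hnB : n < B)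
    (h30 : s 30 0 = e) (h13 : ∀ w < n, s 13 (e * n + w) < B) :
    Run W B output s (n * 150 + 200) (fun s' => ∀ w < n, s' 4 w = row n (s 13) e w) := by
  refine Run.forLoop (N := n) (T := 50) (fun j s' => ∀ w < j, s' 4 w = row n (s 13) e w)
    hW (by decide) (by decide) hnB (by omega) ?_ ?_ ?_
  · intro s' hf
    simp [hf 0 (by decide) (by decide), hn]
  · exact fun w hw => by omega
  · intro j hj s' hf hc hI
    have e0 := hf 0 (by decide) (by decide)
    have e13 := hf 13 (by decide) (by decide)
    have e30 := hf 30 (by decide) (by decide)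
    refine Run.set hW (by decide) (by decide) ?_ (by omega) ⟨by simp [State.write, hc], ?_⟩
    · simpa [hc, e0, e13, e30, hn, h30] using h13 j hj
    · intro w hw
      by_cases hwj : w = j
      · simp [State.write, hc, e0, e13, e30, hn, h30, hwj, row]
      · simpa [State.write, hc, hwj] using hI w (by omega)

/-! ### Labellings and pairs of vertices with the same label -/

/-- Both sides count the ordered pairs of vertices with equal labels, the left one grouped by label.
-/
theorem sumSquares_eq {g : ℕ → ℕ} (hg : ∀ w < n, g w < p) (hcl : ∀ v, cl v ≤ 1) :
    sumSquares p (cnt cl (range n) g) =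
      ∑ a ∈ range n, ∑ b ∈ range n, if g a = g b then 1 else 0 := by
  have h1 : ∀ l, cnt cl (range n) g (2 * l) + cnt cl (range n) g (2 * l + 1) =
      ((range n).filter fun b => g b = l).card := by
    intro l
    rw [cnt, cnt, ← card_union_of_disjoint]
    · congr 1
      ext v
      have := hcl v
      simp only [mem_union, mem_filter]
      constructor
      · rintro (h | h)
        · exact ⟨h.1, by omega⟩
        · exact ⟨h.1, by omega⟩
      · rintro ⟨h, rfl⟩
        rcases (show cl v = 0 ∨ cl v = 1 by omega) with h' | h'
        · exact Or.inl ⟨h, by omega⟩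
        · exact Or.inr ⟨h, by omega⟩
    · rw [disjoint_left]
      intro v hv hv'
      have := (mem_filter.1 hv).2
      have := (mem_filter.1 hv').2
      omega
  have h2 : ∀ a, (∑ b ∈ range n, if g a = g b then 1 else 0) =
      ((range n).filter fun b => g b = g a).card := by
    intro a
    rw [card_filter]
    exact sum_congr rfl fun b _ => by simp only [eq_comm]
  rw [sumSquares]
  simp only [h1, h2]
  rw [← sum_fiberwise_of_maps_to (s := range n) (t := range p) (g := g)]
  · refine sum_congr rfl fun l _ => ?_
    rw [sum_congr rfl fun a ha => by rw [(mem_filter.1 ha).2], sum_const, smul_eq_mul]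
  · intro w hw
    exact mem_range.2 (hg w (mem_range.1 hw))

theorem sumSquares_cnt_le {g : ℕ → ℕ} (hg : ∀ w < n, g w < p) (hcl : ∀ v, cl v ≤ 1) :
    sumSquares p (cnt cl (range n) g) ≤ n * n := by
  rw [sumSquares_eq hg hcl]
  calc _ ≤ ∑ a ∈ range n, ∑ b ∈ range n, 1 :=
        sum_le_sum fun a _ => sum_le_sum fun b _ => by split_ifs <;> omega
    _ = _ := by simp

theorem sumSquares_congr {d d' : ℕ → ℕ} (h : ∀ i < 2 * p, d i = d' i) :
    sumSquares p d = sumSquares p d' :=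
  sum_congr rfl fun l hl => by
    rw [mem_range] at hl
    rw [h _ (by omega), h _ (by omega)]

theorem fairCounts_congr {N : ℕ} {d d' : ℕ → ℕ} (h : ∀ i < 2 * p, d i = d' i) :
    FairCounts n p N d ↔ FairCounts n p N d' :=
  forall₂_congr fun l hl => by rw [h _ (by omega), h _ (by omega)]

end


section

variable {W B n p m K : ℕ} {s : State} {cl : ℕ → ℕ} {A : ℕ → ℕ → ℕ}

/-! ### The dynamic program -/

/-- The number to be maximised: up to a constant, minus twice the cost. -/
def objective (n p : ℕ) (cl : ℕ → ℕ) (A : ℕ → ℕ → ℕ) (g : ℕ → ℕ) : ℕ :=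
  n * n + 2 * score A (range n) g - sumSquares p (cnt cl (range n) g)

/-- `g` is a best fair labelling with `p` labels, where `N` vertices have colour `1`. -/
def IsBestLabelling (n p N : ℕ) (cl : ℕ → ℕ) (A : ℕ → ℕ → ℕ) (g : ℕ → ℕ) : Prop :=
  (∀ w < n, g w < p) ∧ FairCounts n p N (cnt cl (range n) g) ∧
    ∀ g' : ℕ → ℕ, (∀ w < n, g' w < p) → FairCounts n p N (cnt cl (range n) g') →
      objective n p cl A g' ≤ objective n p cl A g

/-- The single cluster is fair, and unused labels satisfy `0 = 0`. This guarantees a positive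
optimum. -/
theorem exists_fair_labelling {N : ℕ} (hp : 0 < p) (hcl1 : ∀ v, cl v ≤ 1)
    (hN : N = ∑ v ∈ range n, cl v) :
    ∃ g : ℕ → ℕ, (∀ w < n, g w < p) ∧ FairCounts n p N (cnt cl (range n) g) := by
  refine ⟨fun _ => 0, fun _ _ => hp, fun l _ => ?_⟩
  have h1 : cnt cl (range n) (fun _ => 0) 1 = N := by
    rw [hN, cnt, card_filter]
    refine sum_congr rfl fun v _ => ?_
    have := hcl1 v
    split_ifs <;> omega
  have h0 : cnt cl (range n) (fun _ => 0) 0 + cnt cl (range n) (fun _ => 0) 1 = n := by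
    rw [cnt, cnt, card_filter, card_filter, ← sum_add_distrib]
    conv_rhs => rw [← card_range n, card_eq_sum_ones]
    refine sum_congr rfl fun v _ => ?_
    have := hcl1 v
    split_ifs <;> omega
  rcases l with _ | l
  · rw [show cnt cl (range n) (fun _ => 0) (2 * 0) = n - N by rw [mul_zero]; omega,
      show cnt cl (range n) (fun _ => 0) (2 * 0 + 1) = N from h1, mul_comm]
  · have hz : ∀ i, 2 ≤ i → cnt cl (range n) (fun _ => 0) i = 0 := by
      intro i hi
      rw [cnt, card_eq_zero, filter_eq_empty_iff]
      intro v _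
      have := hcl1 v
      omega
    rw [hz _ (by omega), hz _ (by omega), zero_mul, zero_mul]

/-- The key of a fair labelling decodes to fair counts, and its cell holds at least the score of the
labelling; so no objective exceeds `F`. The labelling stored in the maximising cell attains `F`. -/
theorem isBestLabelling_of_table {N v k F : ℕ} {sc lab : ℕ → ℕ} {t : ℕ}
    (hp0 : 0 < p) (hpn : p ≤ n) (hcl : BothColours n cl) (hv : v < n)
    (hN : N = ∑ v ∈ range n, cl v) (hKn : K = n ^ (2 * p + 1))
    (h : Table n p K cl A sc lab t (range n) v)
    (hmax : ∀ k < K, FairCounts n p N (digits n k) → 0 < sc (t * K + k) →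
        n * n + 2 * sc (t * K + k) - sumSquares p (digits n k) ≤ F)
    (hatt : F ≠ 0 → k < K ∧ FairCounts n p N (digits n k) ∧ 0 < sc (t * K + k) ∧
        F = n * n + 2 * sc (t * K + k) - sumSquares p (digits n k)) :
    IsBestLabelling n p N cl A (row n lab (t * K + k)) := by
  have hdig : ∀ g : ℕ → ℕ, (∀ w < n, g w < p) → ∀ i < 2 * p,
      digits n (key n cl (range n) g v) i = cnt cl (range n) g i := fun g hg i hi =>
    key_digit hcl subset_rfl (mem_range.2 hv) hpn (fun w hw => hg w (mem_range.1 hw)) hi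
  have hle : ∀ g : ℕ → ℕ, (∀ w < n, g w < p) → FairCounts n p N (cnt cl (range n) g) →
      objective n p cl A g ≤ F := by
    intro g hg hf
    have hk : key n cl (range n) g v < K := by
      rw [hKn]
      exact key_lt hcl subset_rfl (mem_range.2 hv) hpn fun w hw => hg w (mem_range.1 hw)
    have hc := h.complete g fun w hw => hg w (mem_range.1 hw)
    have hpos := score_pos (A := A) (g := g) (mem_range.2 hv)
    refine le_trans ?_ (hmax _ hk ((fairCounts_congr (hdig g hg)).2 hf) (by omega))
    rw [sumSquares_congr (hdig g hg), objective]
    omega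
  -- Scores are positive and the squares sum to at most `n * n`, so the objective of any fair
  -- labelling is positive.
  have hF : F ≠ 0 := by
    obtain ⟨g, hg, hf⟩ := exists_fair_labelling hp0 hcl.1 hN
    have h1 := hle g hg hf
    have h2 := sumSquares_cnt_le hg hcl.1
    have hpos := score_pos (A := A) (g := g) (mem_range.2 hv)
    rw [objective] at h1
    omega
  obtain ⟨hk, hf, hsc, hFe⟩ := hatt hF
  obtain ⟨a1, -, a3, a4⟩ := h.sound k hk (by omega)
  have a1' : ∀ w < n, row n lab (t * K + k) w < p := fun w hw => a1 w (mem_range.2 hw)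
  have hd := hdig _ a1'
  rw [a3] at hd
  refine ⟨a1', (fairCounts_congr hd).1 hf, fun g hg hfg => (hle g hg hfg).trans ?_⟩
  rw [hFe, objective, a4, sumSquares_congr hd]

theorem dynamicProgram_run {N : ℕ} (hW : 16 * B ^ 2 < W) (hn : s 0 0 = n) (hm : s 0 1 = m)
    (hN : s 5 0 = N) (hNn : N = ∑ v ∈ range n, cl v) (hp : s 6 0 = p) (hp2 : 2 ≤ p)
    (hpn : p ≤ n) (hmn : m ≤ n)
    (hz : ∀ a ∈ [8, 9, 10, 12, 13, 29], ∀ x, s a x = 0)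
    (hcls : ∀ v < n, s 1 v = cl v) (hcl : BothColours n cl)
    (hs : ∀ a b, A a b = A b a) (hA : ∀ a b, A a b = 0 ∨ A a b = 1) (hA0 : ∀ a, A a a = 0)
    (hE : ∀ i < m, s 2 i < n ∧ s 3 i < n)
    (hA1 : ∀ a b, A a b = 1 ↔
      ∃ i < m, (s 2 i = a ∧ s 3 i = b) ∨ (s 3 i = a ∧ s 2 i = b))
    (hleaf : ∀ alive ⊆ range n, 2 ≤ alive.card → ∃ u v, IsLeafPair A alive u v)
    (hKn : K = n ^ (2 * p + 1)) (hB : B = 2 * n * K + 1) :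
    Run W B dynamicProgram s (10000 * (n * n * K * K)) (fun s' =>
      ∃ g, IsBestLabelling n p N cl A g ∧ ∀ w < n, s' 4 w = g w) := by
  have hA' : ∀ a b, A a b ≤ 1 := fun a b => by rcases hA a b with h | h <;> omega
  have hn2 : 2 ≤ n := by omega
  -- From `p ≥ 2`; this lets `K` dominate the bound `4 * n * n * n` on the sums of squares.
  have hK5 : n ^ 5 ≤ K := by
    rw [hKn]
    exact Nat.pow_le_pow_right (by omega) (by omega)
  have h4n : 4 * n * n * n ≤ n ^ 5 := by
    calc 4 * n * n * n ≤ (n * n) * n * n * n := by gcongr; nlinarith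
      _ = n ^ 5 := by ring
  have hnn : n * n ≤ 4 * n * n * n := by nlinarith [Nat.zero_le (n * n)]
  have hnn2 : 2 * n ≤ n * n := Nat.mul_le_mul_right n hn2
  have hnK : n ≤ K := by omega
  have hK0 : 0 < K := by omega
  have hKB : n * K + K ≤ 2 * n * K := by nlinarith
  have hB2 : n + n * n < B := by nlinarith
  refine Run.mono (T := ((2 * p + 1) * 200 + 500) + ((m * 200 + 200) +
    ((n * (n * 200 + 300) + 200) + ((n * (p * 300 + 500) + 200) +
    ((n * (n * n * 200 + K * (K * (n * 150 + 700) + 300) + 1100) + 200) +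
    ((K * (p * 300 + 800) + 200) + (n * 150 + 200))))))) ?_ ?_ fun _ _ h => h
  rotate_left
  -- The elimination dominates: `n` rounds, `K * K` pairs of cells each, and a number of steps
  -- linear in `n` per pair.
  · have n1 : 1 ≤ n := by omega
    have e1 : 1 ≤ n * n * K * K := Nat.one_le_iff_ne_zero.2 (by positivity)
    have e2 : n * n * K ≤ n * n * K * K := Nat.le_mul_of_pos_right _ hK0
    have e3 : n * n ≤ n * n * K := Nat.le_mul_of_pos_right _ hK0
    have e4 : n ≤ n * n := Nat.le_mul_of_pos_right _ n1
    have e5 : n * K ≤ n * n * K := Nat.mul_le_mul_right _ e4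
    have e6 : n * K * K ≤ n * n * K * K := Nat.mul_le_mul_right _ e5
    have e7 : K ≤ n * K := Nat.le_mul_of_pos_left _ n1
    have e8 : n * n * n ≤ n * n * K := Nat.mul_le_mul_left _ hnK
    have e9 : n * p ≤ n * n := Nat.mul_le_mul_left _ hpn
    have e10 : K * p ≤ n * K := by rw [mul_comm]; exact Nat.mul_le_mul_right _ hpn
    nlinarith
  -- powers
  refine Run.seq (powers_run hW hn hp hn2 (by rw [← hKn]; omega)) ?_
  rintro s1 f1 ⟨h7, h14⟩
  rw [← hKn] at h14
  -- edges
  refine Run.seq (readEdges_run (m := m) (A := A) hW (by rw [f1 0 (by decide), hn])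
    (by rw [f1 0 (by decide), hm]) (by omega) (by omega)
    (by rw [f1 8 (by decide)]; exact hz 8 (by decide))
    (by rw [f1 2 (by decide), f1 3 (by decide)]; exact hE) hA
    (by rw [f1 2 (by decide), f1 3 (by decide)]; exact hA1)) ?_
  intro s2 f2 h8
  have g2 : ∀ a, a ∉ powers.mods → a ∉ readEdges.mods → s2 a = s a := fun a h h' => by
    rw [f2 a h', f1 a h]
  -- degrees
  refine Run.seq (degrees_run hW (by rw [g2 0 (by decide) (by decide), hn]) (by omega)
    (by rw [g2 9 (by decide) (by decide)]; exact hz 9 (by decide)) hA' h8) ?_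
  intro s3 f3 h9
  have g3 : ∀ a, a ∉ powers.mods → a ∉ readEdges.mods → a ∉ degrees.mods → s3 a = s a :=
    fun a h h' h'' => by rw [f3 a h'', g2 a h h']
  have h7' : ∀ i ≤ 2 * p + 1, s3 7 i = n ^ i := by
    rw [f3 7 (by decide), f2 7 (by decide)]
    exact h7
  have h14' : s3 14 0 = K := by rw [f3 14 (by decide), f2 14 (by decide), h14]
  -- initial tables
  refine Run.seq (initTables_run (cl := cl) (A := A) hW
    (by rw [g3 0 (by decide) (by decide) (by decide), hn])
    (by rw [g3 6 (by decide) (by decide) (by decide), hp]) h14' hKn hpn (by omega)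
    (by omega) (by rw [g3 1 (by decide) (by decide) (by decide)]; exact hcls) hcl h7'
    (by rw [g3 12 (by decide) (by decide) (by decide)]; exact hz 12 (by decide))
    (by rw [g3 13 (by decide) (by decide) (by decide)]; exact hz 13 (by decide)) hA0) ?_
  rintro s4 f4 ⟨htab, hfresh⟩
  have g4 : ∀ a, a ∉ powers.mods → a ∉ readEdges.mods → a ∉ degrees.mods →
      a ∉ initTables.mods → s4 a = s a :=
    fun a h h' h'' h3 => by rw [f4 a h3, g3 a h h' h'']
  -- elimination
  refine Run.seq (eliminate_all_run (p := p) (K := K) (cl := cl) (A := A) hW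
    (by rw [g4 0 (by decide) (by decide) (by decide) (by decide), hn])
    (by rw [f4 14 (by decide), h14']) hKn hpn hcl hs hA'
    (by rw [f4 8 (by decide), f3 8 (by decide)]; exact h8)
    (by rw [g4 10 (by decide) (by decide) (by decide) (by decide)]; exact hz 10 (by decide))
    (by rw [f4 9 (by decide)]; exact h9) hn2 (by omega) hB2 hnK hleaf htab hfresh) ?_
  rintro s5 f5 ⟨v, hv, hT⟩
  have g5 : ∀ a, a ∉ powers.mods → a ∉ readEdges.mods → a ∉ degrees.mods →
      a ∉ initTables.mods → a ∉ (forLoop 15 (V 0 - .lit 1) eliminate).mods → s5 a = s a :=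
    fun a h h' h'' h3 h4 => by rw [f5 a h4, g4 a h h' h'' h3]
  have i0 : s5 0 0 = n := by
    rw [g5 0 (by decide) (by decide) (by decide) (by decide) (by decide), hn]
  -- the best cell
  refine Run.seq (findBest_run (p := p) (K := K) (N := N) hW i0
    (by rw [g5 5 (by decide) (by decide) (by decide) (by decide) (by decide), hN])
    (by rw [g5 6 (by decide) (by decide) (by decide) (by decide) (by decide), hp])
    (by rw [f5 14 (by decide), f4 14 (by decide), h14']) hpn hn2
    (by rw [f5 7 (by decide), f4 7 (by decide)]; exact h7') (by omega) (by omega)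
    (by rw [g5 29 (by decide) (by decide) (by decide) (by decide) (by decide)]
        exact hz 29 (by decide) 0) ?_) ?_
  · intro k hk
    by_cases h0 : s5 12 ((2 * n - 2) * K + k) = 0
    · omega
    · rw [← (hT.sound k hk h0).2.2.2]
      exact score_le hA' subset_rfl
  rintro s6 f6 ⟨hmax, hatt⟩
  -- The cell is named before the best value is known to be nonzero, hence the implication.
  obtain ⟨k, hk⟩ : ∃ k, s6 29 0 ≠ 0 → k < K ∧ FairCounts n p N (digits n k) ∧
      0 < s5 12 ((2 * n - 2) * K + k) ∧
      s6 29 0 = n * n + 2 * s5 12 ((2 * n - 2) * K + k) - sumSquares p (digits n k) ∧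
      s6 30 0 = (2 * n - 2) * K + k := by
    by_cases h : s6 29 0 = 0
    · exact ⟨0, fun h' => absurd h h'⟩
    · obtain ⟨k, h1, h2⟩ := hatt h
      exact ⟨k, fun _ => ⟨h1, h2⟩⟩
  have hbest := isBestLabelling_of_table (by omega) hpn hcl hv hNn hKn hT hmax
    (fun h => ⟨(hk h).1, (hk h).2.1, (hk h).2.2.1, (hk h).2.2.2.1⟩)
  have hne : s6 29 0 ≠ 0 := by
    obtain ⟨g, hg, hf⟩ := exists_fair_labelling (p := p) (by omega) hcl.1 hNn
    have hkey : key n cl (range n) g v < K := by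
      rw [hKn]
      exact key_lt hcl subset_rfl (mem_range.2 hv) hpn fun w hw => hg w (mem_range.1 hw)
    have hdig : ∀ i < 2 * p, digits n (key n cl (range n) g v) i = cnt cl (range n) g i :=
      fun i hi => key_digit hcl subset_rfl (mem_range.2 hv) hpn
        (fun w hw => hg w (mem_range.1 hw)) hi
    have hc := hT.complete g fun w hw => hg w (mem_range.1 hw)
    have hpos := score_pos (A := A) (g := g) (mem_range.2 hv)
    have h1 := hmax _ hkey ((fairCounts_congr hdig).2 hf) (by omega)
    have h2 := sumSquares_cnt_le hg hcl.1
    rw [sumSquares_congr hdig] at h1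
    omega
  -- output
  have i13 : s6 13 = s5 13 := f6 13 (by decide)
  refine Run.mono (output_run hW (by rw [f6 0 (by decide), i0]) (by omega)
    (hk hne).2.2.2.2 ?_) le_rfl ?_
  · intro w hw
    have := hbest.1 w hw
    rw [i13]
    simp only [row] at this
    omega
  · intro s7 _ h
    refine ⟨_, hbest, ?_⟩
    rw [i13] at h
    exact h

end


/-! ### Graphs on `Fin n` as functions on the natural numbers -/

/-- The adjacency matrix, extended by `0`. -/
noncomputable def adj {n : ℕ} (G : SimpleGraph (Fin n)) (a b : ℕ) : ℕ := by
  classical exact if ∃ (ha : a < n) (hb : b < n), G.Adj ⟨a, ha⟩ ⟨b, hb⟩ then 1 else 0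

/-- The colours of the vertices, extended by `0`. -/
def colour {n : ℕ} (col : Fin n → Fin 2) (v : ℕ) : ℕ := if h : v < n then (col ⟨v, h⟩ : ℕ) else 0

section

variable {n p : ℕ} {G : SimpleGraph (Fin n)} {col : Fin n → Fin 2}
  {P Q : Finpartition (univ : Finset (Fin n))} {g g' : ℕ → ℕ}

theorem adj_zero_or_one (G : SimpleGraph (Fin n)) (a b : ℕ) : adj G a b = 0 ∨ adj G a b = 1 := by
  rw [adj]
  split_ifs <;> simp

theorem adj_self (G : SimpleGraph (Fin n)) (a : ℕ) : adj G a a = 0 := by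
  simp [adj]

open Classical in
theorem adj_fin (G : SimpleGraph (Fin n)) (a b : Fin n) :
    adj G a b = if G.Adj a b then 1 else 0 := by
  simp [adj]

theorem adj_eq_one {a b : ℕ} :
    adj G a b = 1 ↔ ∃ (ha : a < n) (hb : b < n), G.Adj ⟨a, ha⟩ ⟨b, hb⟩ := by
  rw [adj]
  split_ifs with h <;> simp [h]

theorem adj_symm (G : SimpleGraph (Fin n)) (a b : ℕ) : adj G a b = adj G b a := by
  have h : adj G a b = 1 ↔ adj G b a = 1 := by
    rw [adj_eq_one, adj_eq_one]
    exact ⟨fun ⟨ha, hb, h⟩ => ⟨hb, ha, h.symm⟩, fun ⟨ha, hb, h⟩ => ⟨hb, ha, h.symm⟩⟩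
  have h1 := adj_zero_or_one G a b
  have h2 := adj_zero_or_one G b a
  omega

theorem colour_fin (col : Fin n → Fin 2) (a : Fin n) : colour col a = (col a : ℕ) := by
  simp [colour]

theorem colour_le (col : Fin n → Fin 2) (v : ℕ) : colour col v ≤ 1 := by
  rw [colour]
  split_ifs <;> omega

/-- The subgraph induced on the remaining vertices is again acyclic. -/
theorem exists_isLeafPair (hG : G.IsAcyclic) (alive : Finset ℕ) (hal : alive ⊆ range n)
    (h2 : 2 ≤ alive.card) : ∃ u v, IsLeafPair (adj G) alive u v := by
  let S : Set (Fin n) := {x | (x : ℕ) ∈ alive}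
  have hnt : Nontrivial S := by
    obtain ⟨a, ha, b, hb, hab⟩ := one_lt_card.1 (show 1 < alive.card by omega)
    refine ⟨⟨⟨⟨a, mem_range.1 (hal ha)⟩, ha⟩, ⟨⟨b, mem_range.1 (hal hb)⟩, hb⟩, ?_⟩⟩
    intro h
    exact hab (congrArg (fun x : S => (x.1 : ℕ)) h)
  obtain ⟨u, v, huv, h⟩ := exists_leaf_pair (hG.induce S)
  refine ⟨u.1, v.1, u.2, v.2, fun h' => huv (Subtype.ext (Fin.ext h')), ?_⟩
  refine sum_eq_single _ (fun w hw hwv => ?_) fun h' => absurd v.2 h'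
  rcases adj_zero_or_one G u.1 w with h0 | h1
  · exact h0
  · obtain ⟨hu, hwn, hadj⟩ := adj_eq_one.1 h1
    have := h ⟨⟨w, hwn⟩, hw⟩ hadj
    exact absurd (congrArg (fun x : S => (x.1 : ℕ)) this) hwv

/-! ### The cost in terms of labels -/

-- `R` is the adjacency of a simple graph, and this is the handshake lemma for it.
open Classical in
theorem two_mul_ncard_pairs {R : Fin n → Fin n → Prop} (hs : ∀ u v, R u v → R v u)
    (hi : ∀ u, ¬ R u u) :
    2 * {e : Sym2 (Fin n) | ∃ u v, e = s(u, v) ∧ R u v}.ncard =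
      ∑ a : Fin n, ∑ b : Fin n, if R a b then 1 else 0 := by
  let H : SimpleGraph (Fin n) := ⟨R, ⟨fun {u v} h => hs u v h⟩, ⟨hi⟩⟩
  have h1 : {e : Sym2 (Fin n) | ∃ u v, e = s(u, v) ∧ R u v} = (H.edgeFinset : Set _) := by
    ext e
    rw [SimpleGraph.coe_edgeFinset]
    induction e with
    | h a b =>
      rw [SimpleGraph.mem_edgeSet]
      constructor
      · rintro ⟨u, v, he, h⟩
        rcases Sym2.eq_iff.1 he with ⟨rfl, rfl⟩ | ⟨rfl, rfl⟩
        · exact h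
        · exact hs _ _ h
      · exact fun h => ⟨a, b, rfl, h⟩
  rw [h1, Set.ncard_coe_finset, ← H.sum_degrees_eq_twice_card_edges]
  refine sum_congr rfl fun a _ => ?_
  rw [← SimpleGraph.card_neighborFinset_eq_degree, SimpleGraph.neighborFinset_eq_filter,
    card_filter]

/-- `g` labels the clusters of `P`. -/
def Labels (P : Finpartition (univ : Finset (Fin n))) (g : ℕ → ℕ) : Prop :=
  ∀ u v : Fin n, P.part u = P.part v ↔ g u = g v

/-- The identity holds for each ordered pair of vertices separately, according to whether they are
equal, adjacent and equally labelled; the term `n` accounts for the diagonal. -/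
theorem two_mul_cost (hP : Labels P g) :
    2 * cost G P + n + 2 * inner (adj G) (range n) (range n) g =
      (∑ a ∈ range n, ∑ b ∈ range n, if g a = g b then 1 else 0) +
        ∑ a ∈ range n, ∑ b ∈ range n, adj G a b := by
  classical
  rw [cost, mul_add, intraCost, interCost,
    two_mul_ncard_pairs (R := fun u v => u ≠ v ∧ ¬ G.Adj u v ∧ P.part u = P.part v)
      (fun u v h => ⟨h.1.symm, fun h' => h.2.1 h'.symm, h.2.2.symm⟩) (fun u h => h.1 rfl),
    two_mul_ncard_pairs (R := fun u v => G.Adj u v ∧ P.part u ≠ P.part v)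
      (fun u v h => ⟨h.1.symm, h.2.symm⟩) (fun u h => h.2 rfl)]
  have hn : n = ∑ a : Fin n, ∑ b : Fin n, if a = b then 1 else 0 := by simp
  conv_lhs => enter [1, 2]; rw [hn]
  rw [inner]
  simp only [Finset.sum_range, mul_sum, ← sum_add_distrib, adj_fin]
  refine sum_congr rfl fun a _ => sum_congr rfl fun b _ => ?_
  by_cases hab : a = b
  · subst hab
    simp
  · by_cases h1 : G.Adj a b <;> by_cases h2 : g a = g b <;>
      simp [hab, h1, h2, hP a b]

/-! ### Fairness in terms of labels -/

theorem card_colorClass_part (hP : Labels P g) (u : Fin n) (i : Fin 2) :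
    (colorClass col (P.part u) i).card = cnt (colour col) (range n) g (2 * g u + i) := by
  rw [cnt, ← card_map Fin.valEmbedding, colorClass]
  congr 1
  ext w
  simp only [mem_map, mem_filter, Fin.valEmbedding_apply, mem_range]
  constructor
  · rintro ⟨a, ⟨ha, hc⟩, rfl⟩
    rw [P.mem_part_iff_part_eq_part (mem_univ _) (mem_univ _), hP] at ha
    exact ⟨a.2, by rw [ha, colour_fin, hc]⟩
  · rintro ⟨hw, h⟩
    have h1 := colour_le col w
    have h2 := i.2
    refine ⟨⟨w, hw⟩, ⟨?_, ?_⟩, rfl⟩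
    · rw [P.mem_part_iff_part_eq_part (mem_univ _) (mem_univ _), hP]
      change g w = g u
      omega
    · rw [← Fin.val_inj, ← colour_fin]
      change colour col w = i
      omega

theorem card_colorClass_add (S : Finset (Fin n)) :
    (colorClass col S 0).card + (colorClass col S 1).card = S.card := by
  rw [← card_union_of_disjoint, colorClass, colorClass, ← filter_or, filter_true_of_mem]
  · intro v _
    have := (col v).2
    simp only [← Fin.val_inj, Fin.val_zero, Fin.val_one]
    omega
  · rw [disjoint_left]
    intro v hv hv'
    have h0 := (mem_filter.1 hv).2
    have h1 := (mem_filter.1 hv').2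
    rw [h0] at h1
    exact absurd h1 (by decide)

/-- Both sizes are sums over the two colours, so after clearing denominators the two conditions
become the same equation. -/
theorem isFairSet_iff (hn : 0 < n) {S : Finset (Fin n)} (hS : S.Nonempty) :
    IsFairSet col S ↔ (colorClass col S 0).card * (colorClass col univ 1).card =
      (colorClass col S 1).card * (colorClass col univ 0).card := by
  have h1 := card_colorClass_add (col := col) S
  have h2 := card_colorClass_add (col := col) univ
  rw [card_univ] at h2
  have hS' : (S.card : ℚ) ≠ 0 := by exact_mod_cast (card_pos.2 hS).ne'
  have hn' : (Fintype.card (Fin n) : ℚ) ≠ 0 := by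
    rw [Fintype.card_fin]
    exact_mod_cast hn.ne'
  rw [IsFairSet, Fin.forall_fin_two, div_eq_div_iff hS' hn', div_eq_div_iff hS' hn', ← h1, ← h2]
  norm_cast
  constructor
  · rintro ⟨h, -⟩
    nlinarith
  · intro h
    constructor <;> nlinarith

theorem card_colour_one : (colorClass col univ 1).card = ∑ v ∈ range n, colour col v := by
  rw [colorClass, card_filter, Finset.sum_range]
  refine sum_congr rfl fun v _ => ?_
  rw [colour_fin]
  have := (col v).2
  simp only [← Fin.val_inj, Fin.val_one]
  split_ifs <;> omega

theorem isFairPartition_iff (hP : Labels P g) (hg : ∀ w < n, g w < p) :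
    IsFairPartition col P ↔ FairCounts n p (∑ v ∈ range n, colour col v)
      (cnt (colour col) (range n) g) := by
  have h0 : (colorClass col univ 0).card = n - ∑ v ∈ range n, colour col v := by
    have h2 := card_colorClass_add (col := col) univ
    rw [card_univ, Fintype.card_fin, card_colour_one] at h2
    omega
  have hpart : ∀ u : Fin n, IsFairSet col (P.part u) ↔
      cnt (colour col) (range n) g (2 * g u) * (∑ v ∈ range n, colour col v) =
      cnt (colour col) (range n) g (2 * g u + 1) * (n - ∑ v ∈ range n, colour col v) := by
    intro u
    rw [isFairSet_iff (u.pos) ⟨u, P.mem_part (mem_univ u)⟩, card_colorClass_part hP,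
      card_colorClass_part hP, ← h0, card_colour_one]
    simp
  constructor
  · intro h l hl
    by_cases hex : ∃ u : Fin n, g u = l
    · obtain ⟨u, rfl⟩ := hex
      exact (hpart u).1 (h _ (P.part_mem.2 (mem_univ u)))
    -- A label that is not used has both counts 0 and imposes no condition.
    · have hz : ∀ i < 2, cnt (colour col) (range n) g (2 * l + i) = 0 := by
        intro i hi
        rw [cnt, card_eq_zero, filter_eq_empty_iff]
        intro v hv
        have := colour_le col v
        intro h'
        exact hex ⟨⟨v, mem_range.1 hv⟩, show g v = l by omega⟩
      have hz0 := hz 0 (by omega)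
      rw [add_zero] at hz0
      rw [hz0, hz 1 (by omega), zero_mul, zero_mul]
  · intro h S hS
    obtain ⟨u, hu⟩ := P.nonempty_of_mem_parts hS
    rw [← P.part_eq_of_mem hS hu, hpart]
    exact h _ (hg u u.2)

/-- The blue share `p / n` of a fair cluster is positive, so each cluster contains a blue vertex.
Hence `P.part` maps the `p` blue vertices onto the clusters. -/
theorem card_parts_le {c : ℕ} (hc : 0 < c) (hn : p * (c + 1) = n) (hcol : HasRatioOneTo c col)
    (hP : IsFairPartition col P) : P.parts.card ≤ p := by
  obtain ⟨blue, red, hne, hcard⟩ := hcol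
  have h2 := card_colorClass_add (col := col) univ
  have h3 : (colorClass col univ blue).card + (colorClass col univ red).card = n := by
    rw [card_univ, Fintype.card_fin] at h2
    fin_cases blue <;> fin_cases red <;> first | exact absurd rfl hne | skip
    · exact h2
    · rw [add_comm]; exact h2
  have hb : (colorClass col univ blue).card = p := by
    rw [hcard] at h3
    have h4 : (c + 1) * (colorClass col univ blue).card = (c + 1) * p := by
      linarith
    exact Nat.eq_of_mul_eq_mul_left (by omega) h4
  have hex : ∀ S ∈ P.parts, ∃ v ∈ S, col v = blue := by
    intro S hS
    have hS' := P.nonempty_of_mem_parts hS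
    obtain ⟨u, -⟩ := hS'
    have hn0 : 0 < n := u.pos
    have hp0 : 0 < p := Nat.pos_of_ne_zero (by rintro rfl; omega)
    have hf := hP S hS blue
    rw [hb] at hf
    have hpos : (0 : ℚ) < (p : ℚ) / (Fintype.card (Fin n) : ℚ) := by
      rw [Fintype.card_fin]
      exact div_pos (by exact_mod_cast hp0) (by exact_mod_cast hn0)
    rw [← hf] at hpos
    have : (colorClass col S blue).card ≠ 0 := by
      intro h0
      simp [h0] at hpos
    obtain ⟨v, hv⟩ := card_pos.1 (Nat.pos_of_ne_zero this)
    exact ⟨v, (mem_filter.1 hv).1, (mem_filter.1 hv).2⟩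
  rw [← hb]
  refine card_le_card_of_surjOn P.part fun S hS => ?_
  obtain ⟨v, hvS, hv⟩ := hex S hS
  exact ⟨v, mem_filter.2 ⟨mem_univ _, hv⟩, P.part_eq_of_mem hS hvS⟩

/-! ### From partitions to labellings and back. -/

theorem exists_labels (hP : P.parts.card ≤ p) : ∃ g : ℕ → ℕ, Labels P g ∧ ∀ w < n, g w < p := by
  let e := P.parts.equivFin
  refine ⟨fun w => if h : w < n then e ⟨P.part ⟨w, h⟩, P.part_mem.2 (mem_univ _)⟩ else 0, ?_, ?_⟩
  · intro u v
    simp [Fin.val_inj]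
  · intro w hw
    simp only [hw, dif_pos]
    omega

theorem exists_partition (g : ℕ → ℕ) :
    ∃ P : Finpartition (univ : Finset (Fin n)), Labels P g := by
  classical
  refine ⟨Finpartition.ofSetoid (Setoid.ker fun u : Fin n => g u), fun u v => ?_⟩
  rw [← Finpartition.mem_part_iff_part_eq_part _ (mem_univ _) (mem_univ _),
    Finpartition.mem_part_ofSetoid_iff_rel, Setoid.ker_def, eq_comm]

/-- The partition given by a best labelling is a solution. -/
theorem isSolution_of_isBestLabelling {c : ℕ} (hc : 0 < c) (hn : p * (c + 1) = n)
    (hcol : HasRatioOneTo c col) (hP : Labels P g)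
    (hg : IsBestLabelling n p (∑ v ∈ range n, colour col v) (colour col) (adj G) g) :
    IsSolution G col P := by
  refine ⟨(isFairPartition_iff hP hg.1).2 hg.2.1, fun Q hQ => ?_⟩
  obtain ⟨g', hQg, hg'⟩ := exists_labels (card_parts_le hc hn hcol hQ)
  have h := hg.2.2 g' hg' ((isFairPartition_iff hQg hg').1 hQ)
  have h1 := two_mul_cost (G := G) hP
  have h2 := two_mul_cost (G := G) hQg
  rw [← sumSquares_eq hg.1 (colour_le col)] at h1
  rw [← sumSquares_eq hg' (colour_le col)] at h2
  -- These two bounds exclude truncation in `objective`, so that the comparison of costs becomes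
  -- linear.
  have h3 := sumSquares_cnt_le hg.1 (colour_le col)
  have h4 := sumSquares_cnt_le hg' (colour_le col)
  rw [objective, objective, score, score, card_range] at h
  omega

/-- Every fair partition is labelled by the constant `0`, so all of them have the same cost. -/
theorem isSolution_of_card_le_one {c : ℕ} (hc : 0 < c) (hn : p * (c + 1) = n) (hp : p ≤ 1)
    (hcol : HasRatioOneTo c col) (hP : Labels P fun _ => 0) : IsSolution G col P := by
  refine ⟨fun S hS => ?_, fun Q hQ => ?_⟩
  · obtain ⟨u, hu⟩ := P.nonempty_of_mem_parts hS
    have : S = univ := by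
      rw [← P.part_eq_of_mem hS hu, eq_univ_iff_forall]
      intro v
      rw [P.mem_part_iff_part_eq_part (mem_univ _) (mem_univ _), hP]
    rw [this]
    intro i
    rw [card_univ]
  · obtain ⟨g', hQg, hg'⟩ := exists_labels (card_parts_le hc hn hcol hQ)
    have h1 := two_mul_cost (G := G) hP
    have h2 := two_mul_cost (G := G) hQg
    have h3 : ∀ w ∈ range n, g' w = 0 := fun w hw => by
      have := hg' w (mem_range.1 hw)
      omega
    have h4 : (∑ a ∈ range n, ∑ b ∈ range n, if g' a = g' b then 1 else 0) =
        ∑ a ∈ range n, ∑ b ∈ range n, if (fun _ : ℕ => 0) a = (fun _ : ℕ => 0) b then 1 else 0 :=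
      sum_congr rfl fun a ha => sum_congr rfl fun b hb => by simp [h3 a ha, h3 b hb]
    rw [h4, inner_congr h3 h3] at h2
    beta_reduce at h1 h2
    omega

/-! ### The program on the input -/

/-- The input does not tell which colour is the rarer one; the minimum of the two counts is `p` in
either case. -/
theorem colours_of_ratio {c : ℕ} (hc : 0 < c) (hn : p * (c + 1) = n)
    (hcol : HasRatioOneTo c col) :
    min (∑ v ∈ range n, colour col v) (n - ∑ v ∈ range n, colour col v) = p ∧
      ∑ v ∈ range n, colour col v ≤ n := by
  obtain ⟨blue, red, hne, hcard⟩ := hcol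
  have h2 := card_colorClass_add (col := col) univ
  rw [card_univ, Fintype.card_fin, card_colour_one] at h2
  have key : ∀ x y : ℕ, y = c * x → x + y = n → x = p ∧ x ≤ y := by
    rintro x y rfl h
    have h4 : (c + 1) * x = (c + 1) * p := by
      rw [mul_comm _ p, hn, ← h]
      ring
    exact ⟨Nat.eq_of_mul_eq_mul_left (by omega) h4, Nat.le_mul_of_pos_left _ hc⟩
  fin_cases blue <;> fin_cases red <;> first | exact absurd rfl hne | skip
  · have hcard' : (colorClass col univ 1).card = c * (colorClass col univ 0).card := hcard
    rw [card_colour_one] at hcard'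
    obtain ⟨k1, k2⟩ := key _ _ hcard' h2
    omega
  · have hcard' : (colorClass col univ 0).card = c * (colorClass col univ 1).card := hcard
    rw [card_colour_one] at hcard'
    obtain ⟨k1, k2⟩ := key _ _ hcard' (by omega)
    omega

theorem bothColours_colour (h0 : 0 < ∑ v ∈ range n, colour col v)
    (h1 : ∑ v ∈ range n, colour col v < n) : BothColours n (colour col) := by
  refine ⟨colour_le col, fun i => ?_⟩
  have hsum : ∀ i, ((range n).filter fun v => colour col v = i).card =
      ∑ v ∈ range n, if colour col v = i then 1 else 0 := fun i => card_filter _ _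
  have hc1 : ((range n).filter fun v => colour col v = 1).card =
      ∑ v ∈ range n, colour col v := by
    rw [hsum]
    refine sum_congr rfl fun v _ => ?_
    have := colour_le col v
    split_ifs <;> omega
  by_cases hi : i = 1
  · rw [hi, hc1]
    exact h1
  · have hd : Disjoint ((range n).filter fun v => colour col v = i)
        ((range n).filter fun v => colour col v = 1) := by
      rw [disjoint_left]
      intro v hv hv'
      exact hi ((mem_filter.1 hv).2.symm.trans (mem_filter.1 hv').2)
    have hle := card_le_card (union_subset
      (filter_subset (fun v => colour col v = i) (range n))
      (filter_subset (fun v => colour col v = 1) (range n)))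
    rw [card_union_of_disjoint hd, card_range, hc1] at hle
    omega

theorem inputState_lt {B : ℕ} {edges : List (Fin n × Fin n)} (hn : n < B) (hm : edges.length < B)
    (hB : 1 < B) (a i : ℕ) : inputState col edges a i < B := by
  unfold inputState
  split
  · exact hn
  · exact hm
  · split_ifs with h
    · have := (col ⟨i, h⟩).2
      omega
    · omega
  · split_ifs with h
    · exact (edges[i].1.2).trans hn
    · omega
  · split_ifs with h
    · exact (edges[i].2.2).trans hn
    · omega
  · omega

theorem adj_eq_one_iff_input {edges : List (Fin n × Fin n)} (he : ListsEdges G edges) (a b : ℕ) :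
    adj G a b = 1 ↔ ∃ i < edges.length,
      (inputState col edges 2 i = a ∧ inputState col edges 3 i = b) ∨
      (inputState col edges 3 i = a ∧ inputState col edges 2 i = b) := by
  have h2 : ∀ i (h : i < edges.length), inputState col edges 2 i = edges[i].1 :=
    fun i h => by simp [inputState, h]
  have h3 : ∀ i (h : i < edges.length), inputState col edges 3 i = edges[i].2 :=
    fun i h => by simp [inputState, h]
  rw [adj_eq_one]
  constructor
  · rintro ⟨ha, hb, h⟩
    rw [← SimpleGraph.mem_edgeSet, ← he.2, List.mem_map] at h
    obtain ⟨e, hmem, heq⟩ := h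
    obtain ⟨i, hi, rfl⟩ := List.getElem_of_mem hmem
    refine ⟨i, hi, ?_⟩
    rw [h2 i hi, h3 i hi]
    rcases Sym2.eq_iff.1 heq with ⟨k1, k2⟩ | ⟨k1, k2⟩
    · left
      rw [k1, k2]
      exact ⟨rfl, rfl⟩
    · right
      rw [k1, k2]
      exact ⟨rfl, rfl⟩
  · rintro ⟨i, hi, h⟩
    have hadj : G.Adj edges[i].1 edges[i].2 := by
      rw [← SimpleGraph.mem_edgeSet, ← he.2, List.mem_map]
      exact ⟨edges[i], List.getElem_mem hi, rfl⟩
    rw [h2 i hi, h3 i hi] at h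
    rcases h with ⟨rfl, rfl⟩ | ⟨rfl, rfl⟩
    · exact ⟨edges[i].1.2, edges[i].2.2, hadj⟩
    · exact ⟨edges[i].2.2, edges[i].1.2, hadj.symm⟩

/-- The common beginning of the cases `p ≥ 2` and `p ≤ 1`; the final branch is left to the
hypothesis `h`. -/
theorem solver_run {W B N T : ℕ} {cl : ℕ → ℕ} {s : State} {R : State → Prop}
    (hW : 16 * B ^ 2 < W) (hn : s 0 0 = n) (hnB : n < B)
    (h5 : s 5 0 = 0) (hcls : ∀ v < n, s 1 v = cl v) (hcl1 : ∀ v, cl v ≤ 1)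
    (hN : N = ∑ v ∈ range n, cl v) (hNn : N ≤ n)
    (h : ∀ s', (∀ a, a ≠ 5 → a ≠ 6 → a ≠ 24 → s' a = s a) → s' 5 0 = N →
      s' 6 0 = min N (n - N) →
      Run W B (.ite (.less (.lit 1) (V 6)) dynamicProgram .skip) s' T R) :
    Run W B solver s (n * 200 + 300 + T) R := by
  refine Run.mono (T := (n * 200 + 200) + (100 + T)) (Run.seq
    (countColours_run hW hn hnB h5 hcls hcl1) ?_) (by omega) fun _ _ h => h
  intro s1 f1 h1
  have e0 : s1 0 0 = n := by rw [f1 0 (by decide), hn]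
  have e5 : s1 5 0 = N := by rw [h1, hN]
  refine Run.seq (R := fun s' => s' 6 0 = min N (n - N)) ?_ ?_
  · refine Run.ite hW (by decide) (by decide) (by omega) ?_ ?_
    · intro hlt
      have hlt' : N + N < n := by simpa [e0, e5, Nat.lt_sub_iff_add_lt] using hlt
      refine Run.set hW (by decide) (by decide) (by simp [e5]; omega) (by omega) ?_
      simp [State.write, e5]
      omega
    · intro hlt
      have hlt' : n - N ≤ N := by simpa [e0, e5] using hlt
      refine Run.set hW (by decide) (by decide) (by simp [e5, e0]; omega) (by omega) ?_
      simp [State.write, e5, e0]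
      omega
  · intro s2 f2 h2
    refine h s2 (fun a ha5 ha6 ha24 => ?_) (by rw [f2 5 (by decide), e5]) h2
    rw [f2 a (by simpa [Prog.mods] using ha6), f1 a]
    rw [countColours, Prog.mem_mods_forLoop]
    simp [Prog.mods, ha5, ha24]

end

end FairCC

/-! ### The main theorem. -/

theorem mainTheorem6 :
    ∃ (q : FairCC.Prog) (C : ℕ),
      ∀ (n c p : ℕ) (G : SimpleGraph (Fin n)) (col : Fin n → Fin 2)
        (edges : List (Fin n × Fin n)),
        0 < c → p * (c + 1) = n →
        G.IsAcyclic → FairCC.HasRatioOneTo c col → FairCC.ListsEdges G edges →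
        FairCC.SolvesWithin q G col edges
          (C * n ^ (p ^ 3 + p ^ 2 + p)) (C * n ^ (p ^ 3 + p ^ 2 + p)) := by
  -- The constant covers `10000 * (n * n * K * K)` steps of the dynamic program with the linear
  -- overhead, and the word bound `144 * (n * n * K * K)`.
  refine ⟨FairCC.solver, 20000, fun n c p G col edges hc hn hG hcol he => ?_⟩
  have hm := FairCC.card_edges_le hG he
  obtain ⟨hmin, hNn⟩ := FairCC.colours_of_ratio hc hn hcol
  have hcls : ∀ v < n, FairCC.inputState col edges 1 v = FairCC.colour col v := fun v hv => by
    simp [FairCC.inputState, FairCC.colour]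
  rcases Nat.lt_or_ge 1 p with hp | hp
  · -- at least two clusters are possible
    have hpn : 2 * p ≤ n := by
      rw [← hn, mul_comm]
      exact Nat.mul_le_mul_left p (by omega)
    obtain ⟨K, hK⟩ : ∃ K, K = n ^ (2 * p + 1) := ⟨_, rfl⟩
    -- From `p ^ 2 ≥ 4` follow `p ^ 3 ≥ 4 * p` and `p ^ 3 + p ^ 2 ≥ 4 * p + 4`.
    have hX : n * n * K * K ≤ n ^ (p ^ 3 + p ^ 2 + p) := by
      have : n * n * K * K = n ^ (4 * p + 4) := by
        rw [hK]
        ring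
      rw [this]
      refine Nat.pow_le_pow_right (by omega) ?_
      have : 4 ≤ p ^ 2 := Nat.pow_le_pow_left hp 2
      have : p ^ 3 = p ^ 2 * p := pow_succ p 2
      nlinarith
    have hnK : n ≤ K := by
      rw [hK]
      exact Nat.le_self_pow (by omega) n
    have hnX : n ≤ n * n * K * K := by
      calc n = n * 1 * 1 * 1 := by ring
        _ ≤ n * n * K * K := by gcongr <;> omega
    -- Stored words include numbers of cells in fewer than `2 * n` tables, so `B = 2 * n * K + 1`.
    have hW : 16 * (2 * n * K + 1) ^ 2 < 20000 * n ^ (p ^ 3 + p ^ 2 + p) := by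
      have h1 : 1 ≤ n * K := Nat.one_le_iff_ne_zero.2 (Nat.mul_ne_zero (by omega) (by omega))
      calc 16 * (2 * n * K + 1) ^ 2 ≤ 16 * (3 * (n * K)) ^ 2 := by gcongr; linarith
        _ = 144 * (n * n * K * K) := by ring
        _ < 20000 * (n * n * K * K) := by omega
        _ ≤ _ := Nat.mul_le_mul_left _ hX
    have hnB : n < 2 * n * K + 1 := by nlinarith
    have hrun := FairCC.solver_run (n := n) (B := 2 * n * K + 1) (s := FairCC.inputState col edges)
      (cl := FairCC.colour col) (T := 10000 * (n * n * K * K) + 50)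
      (R := fun s' => ∃ g, FairCC.IsBestLabelling n p (∑ v ∈ Finset.range n, FairCC.colour col v)
        (FairCC.colour col) (FairCC.adj G) g ∧ ∀ w < n, s' 4 w = g w)
      hW rfl hnB rfl hcls (FairCC.colour_le col) rfl hNn ?_
    · obtain ⟨s', t, h1, h2, -, -, g, hg, h4⟩ :=
        hrun (FairCC.inputState_lt hnB (by omega) (by omega))
      obtain ⟨P, hP⟩ := FairCC.exists_partition (n := n) g
      refine ⟨s', t, h1, ?_, P, fun u v => ?_,
        FairCC.isSolution_of_isBestLabelling hc hn hcol hP hg⟩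
      · have := Nat.mul_le_mul_left 20000 hX
        omega
      · rw [hP u v, h4 u u.2, h4 v v.2]
    · intro s' f h5 h6
      have h6' : s' 6 0 = p := by rw [h6, hmin]
      refine FairCC.Run.ite hW (by decide) (by decide) (by omega) (fun _ => ?_) fun h0 => ?_
      · refine FairCC.Run.mono (FairCC.dynamicProgram_run (p := p) (m := edges.length)
          (A := FairCC.adj G) hW (by rw [f 0 (by decide) (by decide) (by decide)]; rfl)
          (by rw [f 0 (by decide) (by decide) (by decide)]; rfl) h5 rfl h6' hp (by omega) hm ?_
          (by rw [f 1 (by decide) (by decide) (by decide)]; exact hcls)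
          (FairCC.bothColours_colour (by omega) (by omega)) (FairCC.adj_symm G)
          (FairCC.adj_zero_or_one G) (FairCC.adj_self G) ?_ ?_
          (FairCC.exists_isLeafPair hG) hK rfl) (by omega) fun _ _ h => h
        · intro a ha x
          simp only [List.mem_cons, List.not_mem_nil, or_false] at ha
          rw [f a (by omega) (by omega) (by omega)]
          rcases ha with rfl | rfl | rfl | rfl | rfl | rfl <;> rfl
        · rw [f 2 (by decide) (by decide) (by decide), f 3 (by decide) (by decide) (by decide)]
          intro i hi
          simp [FairCC.inputState, hi]
        · rw [f 2 (by decide) (by decide) (by decide), f 3 (by decide) (by decide) (by decide)]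
          exact FairCC.adj_eq_one_iff_input he
      · exfalso
        simp [h6'] at h0
        omega
  · -- there is only one cluster
    -- For `p = 0` also `n = 0`, and the time bound is positive only because `0 ^ 0 = 1`.
    have hexp : n ^ (p ^ 3 + p ^ 2 + p) ≥ n ^ 2 ∧ 1 ≤ n ^ (p ^ 3 + p ^ 2 + p) := by
      rcases Nat.lt_or_ge p 1 with h | h
      · obtain rfl : p = 0 := by omega
        obtain rfl : n = 0 := by omega
        simp
      · obtain rfl : p = 1 := by omega
        have : 1 ≤ n := by omega
        exact ⟨Nat.pow_le_pow_right this (by norm_num), Nat.one_le_pow _ _ this⟩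
    have hW : 16 * (n + 2) ^ 2 < 20000 * n ^ (p ^ 3 + p ^ 2 + p) := by nlinarith
    have hrun := FairCC.solver_run (n := n) (B := n + 2) (s := FairCC.inputState col edges)
      (cl := FairCC.colour col) (T := 100)
      (R := fun s' => ∀ w, s' 4 w = 0)
      hW rfl (by omega) rfl hcls (FairCC.colour_le col) rfl hNn ?_
    · obtain ⟨s', t, h1, h2, -, -, h4⟩ := hrun
        (FairCC.inputState_lt (by omega) (by omega) (by omega))
      obtain ⟨P, hP⟩ := FairCC.exists_partition (n := n) fun _ => 0
      refine ⟨s', t, h1, ?_, P, fun u v => ?_,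
        FairCC.isSolution_of_card_le_one hc hn hp hcol hP⟩
      · nlinarith
      · rw [hP u v, h4, h4]
    · intro s' f h5 h6
      refine FairCC.Run.ite hW (by decide) (by decide) (by omega) (fun h0 => ?_) fun _ => ?_
      · exfalso
        rw [hmin] at h6
        simp [h6] at h0
        omega
      -- Array `4` has not been written, so all vertices carry the label `0`.
      · refine FairCC.Run.skip (fun w => ?_) (by omega)
        rw [f 4 (by decide) (by decide) (by decide)]
        rfl
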